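/- All algebras are finite dimensional C*-algebras $\mathcal A=\bigoplus_i B(H_i)$, with trace $\mathrm{Tr}\,(a_i)_i=\sum_i\mathrm{Tr}\,a_i$, trace norm $\|a\|_1=\mathrm{Tr}\,|a|$, and state space $\mathfrak S(\mathcal A)=\{\sigma\ge 0,\ \mathrm{Tr}\,\sigma=1\}$. Let $\mathcal C(\mathcal A,\mathcal B)$ be the set of channels, that is, of completely positive trace preserving linear maps $\mathcal A\to\mathcal B$. For Hermitian linear maps $\phi:\mathcal A\to\mathcal B$ and $\psi:\mathcal B\to\mathcal A$ put $\langle\phi,\psi\rangle=s(\phi\circ\psi)$, where $s(\chi)=\sum_{i,j}\langle i|\chi(|i\rangle\langle j|)|j\rangle$, the sum being over pairs of standard basis vectors of a common block. Let $CP^*(\mathcal B,\mathcal D)$ be the cone of Hermitian maps $\Gamma:\mathcal B\to\mathcal D$ with $\langle\phi,\Gamma\rangle\ge0$ for all completely positive $\phi:\mathcal D\to\mathcal B$ (this is again the cone of completely positive maps), and let $$\|\Gamma\|^\diamond=\sup\{\langle\xi,\Gamma\rangle:\ \xi:\mathcal D\to\mathcal B,\ \alpha\pm\xi \text{ completely positive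 for some } \alpha\in\mathcal C(\mathcal D,\mathcal B)\}$$ be the norm dual to the diamond norm. Let $\Phi\in\mathcal C(\mathcal A,\mathcal B)$, $\Psi\in\mathcal C(\mathcal A',\mathcal B)$. For $\epsilon\ge0$ and $k\in\mathbb N$ write $\Psi\succeq^{\epsilon,k}\Phi$ if for every $\Gamma\in CP^*(\mathcal B,B(\mathbb C^k))$ and every $\beta\in\mathcal C(B(\mathbb C^k),\mathcal A)$ there is some $\beta'\in\mathcal C(B(\mathbb C^k),\mathcal A')$ such that $\langle\Phi\circ\beta,\Gamma\rangle\le\langle\Psi\circ\beta',\Gamma\rangle+\epsilon\|\Gamma\|^\diamond$. For channels $\Phi_1,\Psi_1$ with a common output algebra write $\Psi_1\supseteq_\epsilon\Phi_1$ if for every state $\sigma$ of the input algebra of $\Phi_1$ there is a state $\rho$ of the input algebra of $\Psi_1$ with $\|\Phi_1(\sigma)-\Psi_1(\rho)\|_1\le2\epsilon$. **Theorem.** Let $k\in\mathbb N$, $\epsilon\ge0$, and let $D=\mathbb C^k$. Consider the following statements. (i) $\Psi\succeq^{\epsilon,k}\Phi$. (ii) $\Psi\otimes\xi\supseteq_\epsilon\Phi\otimes\xi$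 for every finite dimensional Hilbert space $H'$ and every channel $\xi\in\mathcal C(B(D),B(H'))$. (iii) $\Psi\otimes id_{B(D)}\supseteq_\epsilon\Phi\otimes id_{B(D)}$. Then (i) $\Rightarrow$ (ii) $\Rightarrow$ (iii) $\Rightarrow\ \Psi\succeq^{\epsilon',k}\Phi$, where $\epsilon'=\epsilon+\tfrac12\sqrt\epsilon$. -/

import Mathlib

namespace ChannelComparison

open scoped ComplexOrder

/-- The finite dimensional C*-algebra `⨁ i, B(H i)`, where `H i = ℂ^(n i)`, with componentwise
operations. -/
abbrev Alg {ι : Type*} (n : ι → Type*) : Type _ := ∀ i, Matrix (n i) (n i) ℂ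

/-- The shape of the full matrix algebra `B(D)` with `D = ℂ^k`: one block, of size `k`. -/
abbrev Full (k : ℕ) : Unit → Type := fun _ => Fin k

/-- The shape of the tensor product of two block algebras: the blocks are indexed by pairs, and
`B(H i) ⊗ B(K j) = B(H i ⊗ K j)`. -/
abbrev TensorShape {ι κ : Type*} (n : ι → Type*) (m : κ → Type*) : ι × κ → Type _ :=
  fun p => n p.1 × m p.2

/-- The elementary tensor `x ⊗ y`. -/
def tmul {ι κ : Type*} {n : ι → Type*} {m : κ → Type*} (x : Alg n) (y : Alg m) :
    Alg (TensorShape n m) :=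
  fun p => Matrix.kroneckerMap (fun s t : ℂ => s * t) (x p.1) (y p.2)

/-- The matrix unit `|a⟩⟨b|` in block `i`. -/
def matUnit {ι : Type*} [DecidableEq ι] {n : ι → Type*} [∀ i, DecidableEq (n i)]
    (i : ι) (a b : n i) : Alg n :=
  Pi.single i (Matrix.single a b (1 : ℂ))

/-- Positive elements of the algebra. -/
def IsPos {ι : Type*} {n : ι → Type*} (x : Alg n) : Prop :=
  ∀ i, (x i).PosSemidef

section Algebras

variable {ι : Type*} [Fintype ι] {n : ι → Type*} [∀ i, Fintype (n i)]

/-- The trace of the algebra (the restriction of the trace of `B(⨁ i, H i)`). -/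
def tr (x : Alg n) : ℂ := ∑ i, (x i).trace

/-- States: positive elements of trace one. -/
def IsState (x : Alg n) : Prop := IsPos x ∧ tr x = 1

/-- The trace norm: the sum of the singular values. -/
noncomputable def traceNorm [∀ i, DecidableEq (n i)] (x : Alg n) : ℝ :=
  ∑ i, ∑ a, Real.sqrt ((Matrix.isHermitian_conjTranspose_mul_self (x i)).eigenvalues a)

end Algebras

section Tensor

variable {ι κ ι' κ' : Type*} [Fintype ι] [DecidableEq ι] [Fintype κ] [DecidableEq κ]
  {n : ι → Type*} [∀ i, Fintype (n i)] [∀ i, DecidableEq (n i)]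
  {m : κ → Type*} [∀ j, Fintype (m j)] [∀ j, DecidableEq (m j)]
  {n' : ι' → Type*} {m' : κ' → Type*}

/-- The tensor product `φ ⊗ ψ` of two linear maps, through the expansion of an element in
tensor products of matrix units. -/
def tensorMap (φ : Alg n →ₗ[ℂ] Alg n') (ψ : Alg m →ₗ[ℂ] Alg m') :
    Alg (TensorShape n m) →ₗ[ℂ] Alg (TensorShape n' m') where
  toFun x := ∑ i, ∑ j, ∑ a, ∑ b, ∑ c, ∑ d,
    x (i, j) (a, c) (b, d) • tmul (φ (matUnit i a b)) (ψ (matUnit j c d))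
  map_add' x y := by
    simp only [Pi.add_apply, Matrix.add_apply, add_smul, Finset.sum_add_distrib]
  map_smul' r x := by
    simp only [Pi.smul_apply, Matrix.smul_apply, smul_eq_mul, mul_smul, Finset.smul_sum,
      RingHom.id_apply]

end Tensor

section Maps

variable {ι κ : Type*} [Fintype ι] [DecidableEq ι] [Fintype κ] [DecidableEq κ]
  {n : ι → Type*} [∀ i, Fintype (n i)] [∀ i, DecidableEq (n i)]
  {m : κ → Type*} [∀ j, Fintype (m j)] [∀ j, DecidableEq (m j)]

/-- Hermitian maps: linear maps which commute with the involution. -/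
def IsHermitianMap (φ : Alg n →ₗ[ℂ] Alg m) : Prop :=
  ∀ x : Alg n, φ (star x) = star (φ x)

/-- Completely positive maps: `φ ⊗ id` is positive for every matrix ancilla. -/
def IsCP (φ : Alg n →ₗ[ℂ] Alg m) : Prop :=
  ∀ (r : ℕ) (x : Alg (TensorShape n (Full r))), IsPos x →
    IsPos (tensorMap φ (LinearMap.id : Alg (Full r) →ₗ[ℂ] Alg (Full r)) x)

/-- Channels: completely positive trace preserving maps. -/
def IsChannel (φ : Alg n →ₗ[ℂ] Alg m) : Prop :=
  IsCP φ ∧ ∀ x, tr (φ x) = tr x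

/-- The functional `s(χ) = ∑ ⟨a, χ(|a⟩⟨b|) b⟩`. Matrix units between different blocks do not
contribute, as maps of block algebras are extended by the conditional expectations. -/
def sFunctional (χ : Alg n →ₗ[ℂ] Alg n) : ℂ :=
  ∑ i, ∑ a, ∑ b, χ (matUnit i a b) i a b

/-- The duality `⟨φ, ψ⟩ = s(φ ∘ ψ)`, which is real for Hermitian maps. -/
def pairing (φ : Alg n →ₗ[ℂ] Alg m) (ψ : Alg m →ₗ[ℂ] Alg n) : ℝ :=
  (sFunctional (φ ∘ₗ ψ)).re

/-- The cone of Hermitian maps which is dual to the cone of completely positive maps in the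
opposite direction. -/
def InDualCP (Γ : Alg n →ₗ[ℂ] Alg m) : Prop :=
  IsHermitianMap Γ ∧ ∀ φ : Alg m →ₗ[ℂ] Alg n, IsCP φ → 0 ≤ pairing φ Γ

/-- The unit ball of the diamond norm: Hermitian maps `ξ` with `-α ≤ ξ ≤ α` for a channel `α`, in
the completely positive order. -/
def diamondBall : Set (Alg n →ₗ[ℂ] Alg m) :=
  {ξ | ∃ α : Alg n →ₗ[ℂ] Alg m, IsChannel α ∧ IsCP (α - ξ) ∧ IsCP (α + ξ)}

/-- The dual of the diamond norm: the supremum of the pairing over the unit ball of the diamond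
norm in the opposite direction. -/
noncomputable def dualDiamondNorm (Γ : Alg n →ₗ[ℂ] Alg m) : ℝ :=
  sSup ((fun ξ => pairing ξ Γ) '' (diamondBall : Set (Alg m →ₗ[ℂ] Alg n)))

end Maps

section Comparison

variable {ι ι' κ δ : Type*} [Fintype ι] [DecidableEq ι] [Fintype ι'] [DecidableEq ι']
  [Fintype κ] [DecidableEq κ] [Fintype δ] [DecidableEq δ]
  {a : ι → Type*} [∀ i, Fintype (a i)] [∀ i, DecidableEq (a i)]
  {a' : ι' → Type*} [∀ i, Fintype (a' i)] [∀ i, DecidableEq (a' i)]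
  {b : κ → Type*} [∀ j, Fintype (b j)] [∀ j, DecidableEq (b j)]

/-- `Ψ` is `(ε, 𝒟)`-pre-processing deficient with respect to `Φ`, where `𝒟 = Alg d`: for each payoff
map `Γ` and each decision rule `β` for `Φ` there is a decision rule `β'` for `Ψ` whose payoff is
smaller by at most `ε ‖Γ‖^⋄`. -/
def PreDeficient (ε : ℝ) (d : δ → Type*) [∀ i, Fintype (d i)] [∀ i, DecidableEq (d i)]
    (Ψ : Alg a' →ₗ[ℂ] Alg b) (Φ : Alg a →ₗ[ℂ] Alg b) : Prop :=
  ∀ Γ : Alg b →ₗ[ℂ] Alg d, InDualCP Γ →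
    ∀ β : Alg d →ₗ[ℂ] Alg a, IsChannel β →
      ∃ β' : Alg d →ₗ[ℂ] Alg a', IsChannel β' ∧
        pairing (Φ ∘ₗ β) Γ ≤ pairing (Ψ ∘ₗ β') Γ + ε * dualDiamondNorm Γ

/-- `Ψ ⊇_ε Φ`: each output state of `Φ` is within trace norm distance `2 ε` of an output state
of `Ψ`. -/
def RangeContains (ε : ℝ) (Ψ : Alg a' →ₗ[ℂ] Alg b) (Φ : Alg a →ₗ[ℂ] Alg b) : Prop :=
  ∀ σ : Alg a, IsState σ → ∃ ρ : Alg a', IsState ρ ∧ traceNorm (Φ σ - Ψ ρ) ≤ 2 * ε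

end Comparison

end ChannelComparison

open ChannelComparison

namespace ChannelComparison

open scoped ComplexOrder
open Matrix

/-! The pivot is `EffectDominated`: for every effect `g` on the output tensored with `B(D)` and
every state `σ` there is a state `ρ` with `g((Φ ⊗ id) σ) ≤ g((Ψ ⊗ id) ρ) + ε`.

(i) gives domination. After a small perturbation `σ` has an invertible marginal on `D`, so it equals
`(1 ⊗ Bᴴ) C (1 ⊗ B)` with `C` the Choi matrix of a channel. Moving `B` into `g` produces a payoff
map whose dual diamond norm is at most the trace of that marginal, which is close to one. Domination
gives (ii). Effects pull back to effects along `id ⊗ ξ`, and Sion's minimax theorem yields one `ρ`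
that serves all effects at once. (iii) gives domination, because the trace distance bounds
differences of effect values.

The loss `½√ε` arises in passing from domination to deficiency. Let `g` be the positive functional
of a payoff map. Semidefinite duality (`exists_optimal_choi_and_dual`) gives `S ≥ 0` with `g ≤ Tr(S
· marg)` and `Tr S ≤ ‖Γ‖^⋄`, and `T ≥ 0` bounding `g ∘ (Ψ ⊗ id)` in the same way, with `Tr T` the
best payoff for `Ψ`. A Choi matrix of a channel has marginal one, so it suffices that `g ∘ (Φ ⊗ id)`
is bounded by `T + ε' S`. A congruence on `D` reduces to `S = 1`, so that `g` is an effect, and `T =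
diag z`. Domination, applied to a rescaled and shifted effect, bounds `g ∘ (Φ ⊗ id)` by the weight
`N = z + ε r` with `r = max ((1 - z)/α) (z/β)` (`EffectDominated.re_le_wsum`). The weight `1` is a
bound as well, hence so is the harmonic mean `N/(s + cN)` (`re_le_wsum_harmonic`). If `ε' < 1`,
suitable `α, β, s, c` depending only on `ε` make this at most `z + ε + ½√ε` for all `z ≥ 0`
(`exists_weights`); if `ε' ≥ 1`, the weight `1` already suffices. -/

/-! ### The scalar inequality behind the constant `½√ε`. -/

/-- Here `q = √ε`. With `N = z + q² max(…)` the claim is `N/(s + cN) ≤ z + q² + q/2`. Where `z/β` is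
the larger term, `N` is linear in `z`, and `s`, `c` are chosen so that the excess of `N/(s + cN)`
over `z` is largest at `N = 1`. -/
lemma exists_weights_of_le_half {q : ℝ} (hq : 0 < q) (hq2 : q ≤ 1 / 2) :
    ∃ α β s c : ℝ, 0 < α ∧ 0 < β ∧ 0 < s ∧ 0 < c ∧ α + β = 1 ∧ s + c = 1 ∧ ∀ z : ℝ, 0 ≤ z →
      z + q ^ 2 * max ((1 - z) / α) (z / β) ≤
        (z + (q ^ 2 + q / 2)) * (s + c * (z + q ^ 2 * max ((1 - z) / α) (z / β))) := by
  have hα : 0 < 1 - 2 * q + 3 * q ^ 2 := by nlinarith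
  have hβ : 0 < 2 * q - 3 * q ^ 2 := by nlinarith
  have hd : 0 < 2 - 2 * q := by linarith
  have hs : 0 < 2 - 3 * q := by linarith
  have hd' : 1 - q ≠ 0 := by linarith
  have hs' : 2 - 3 * q ≠ 0 := hs.ne'
  have hα' : 1 - 2 * q + 3 * q ^ 2 ≠ 0 := hα.ne'
  refine ⟨1 - 2 * q + 3 * q ^ 2, 2 * q - 3 * q ^ 2, (2 - 3 * q) / (2 - 2 * q), q / (2 - 2 * q),
    hα, hβ, by positivity, by positivity, by ring, by field_simp; ring, fun z hz => ?_⟩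
  rcases le_total (z / (2 * q - 3 * q ^ 2)) ((1 - z) / (1 - 2 * q + 3 * q ^ 2)) with h | h
  · rw [max_eq_left h]
    have hzβ : z ≤ 2 * q - 3 * q ^ 2 := by
      rw [div_le_div_iff₀ hβ hα] at h
      nlinarith
    -- Up to a positive factor this is the defect of the inequality. It is exactly the sum of the
    -- left-out nonnegative quantities `e4`, `e5`, `e6`, `e7` below.
    have key : 0 ≤ (1 - 2 * q + 2 * q ^ 2) * z ^ 2 +
        (-1 + 4.5 * q - 4 * q ^ 2 - q ^ 3 + 2 * q ^ 4) * z +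
        (1 - 2 * q) * (2 - 3 * q - 4 * q ^ 2 + 8 * q ^ 3) / 2 := by
      have e1 : 0 ≤ q / 2 - q ^ 3 + 2 * q ^ 4 := by
        have : 0 ≤ q * (1 / 2 - q ^ 2) := mul_nonneg hq.le (by nlinarith)
        nlinarith [pow_pos hq 4]
      have e2 : 0 ≤ (1 - 2 * q) * (2 * q - 3 * q ^ 2 - z) :=
        mul_nonneg (by linarith) (by linarith)
      have e3 : 0 ≤ 1 - 3.5 * q + 5 * q ^ 2 - 2 * q ^ 3 := by
        nlinarith [sq_nonneg (q - 1 / 2), sq_nonneg (q - 2 / 5), mul_nonneg hq.le (sq_nonneg (q - 1 / 2))]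
      have e4 : 0 ≤ (1 - 2 * q) * (1 - 3.5 * q + 5 * q ^ 2 - 2 * q ^ 3) :=
        mul_nonneg (by linarith) e3
      have e5 : 0 ≤ (1 - 2 * q + 2 * q ^ 2) * z ^ 2 := by
        apply mul_nonneg _ (sq_nonneg z); nlinarith
      have e6 := mul_nonneg (by linarith : (0:ℝ) ≤ 1 - 2 * q) e2
      have e7 := mul_nonneg e1 hz
      nlinarith
    have e : (z + (q ^ 2 + q / 2)) * ((2 - 3 * q) / (2 - 2 * q) +
        q / (2 - 2 * q) * (z + q ^ 2 * ((1 - z) / (1 - 2 * q + 3 * q ^ 2)))) -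
        (z + q ^ 2 * ((1 - z) / (1 - 2 * q + 3 * q ^ 2))) =
        q * ((1 - 2 * q + 2 * q ^ 2) * z ^ 2 +
        (-1 + 4.5 * q - 4 * q ^ 2 - q ^ 3 + 2 * q ^ 4) * z +
        (1 - 2 * q) * (2 - 3 * q - 4 * q ^ 2 + 8 * q ^ 3) / 2) /
        ((2 - 2 * q) * (1 - 2 * q + 3 * q ^ 2)) := by
      obtain ⟨A, hA⟩ : ∃ A, A = 1 - 2 * q + 3 * q ^ 2 := ⟨_, rfl⟩
      rw [← hA] at hα' ⊢
      field_simp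
      rw [hA]
      ring
    have : 0 ≤ q * ((1 - 2 * q + 2 * q ^ 2) * z ^ 2 +
        (-1 + 4.5 * q - 4 * q ^ 2 - q ^ 3 + 2 * q ^ 4) * z +
        (1 - 2 * q) * (2 - 3 * q - 4 * q ^ 2 + 8 * q ^ 3) / 2) /
        ((2 - 2 * q) * (1 - 2 * q + 3 * q ^ 2)) := by positivity
    linarith
  · rw [max_eq_right h]
    have hn : z + q ^ 2 * (z / (2 * q - 3 * q ^ 2)) = z * (2 - 2 * q) / (2 - 3 * q) := by
      have : 2 * q - 3 * q ^ 2 = q * (2 - 3 * q) := by ring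
      obtain ⟨B, hB⟩ : ∃ B, B = 2 - 3 * q := ⟨_, rfl⟩
      rw [this]
      rw [← hB] at hs' ⊢
      field_simp
      rw [hB]
      ring
    rw [hn]
    -- Equivalent to `q² (1 - 2q) ≥ 0`: this is where `q ≤ 1/2` enters, with equality at `q = 1/2`.
    have ht : q / (2 - 2 * q) ≤ q ^ 2 + q / 2 := by
      rw [div_le_iff₀ hd]; nlinarith [mul_nonneg hq.le (mul_nonneg hq.le (sub_nonneg.2 hq2))]
    -- The defect is a perfect square, vanishing at `z = s`, that is, at `N = 1`.
    have e : (z + q / (2 - 2 * q)) * ((2 - 3 * q) / (2 - 2 * q) +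
        q / (2 - 2 * q) * (z * (2 - 2 * q) / (2 - 3 * q))) - z * (2 - 2 * q) / (2 - 3 * q) =
        q / ((2 - 2 * q) * (2 - 3 * q)) * (z * (2 - 2 * q) - (2 - 3 * q)) ^ 2 / (2 - 2 * q) := by
      field_simp
      ring
    have e' : 0 ≤ q / ((2 - 2 * q) * (2 - 3 * q)) * (z * (2 - 2 * q) - (2 - 3 * q)) ^ 2 /
        (2 - 2 * q) := by positivity
    have : (z + q / (2 - 2 * q)) * ((2 - 3 * q) / (2 - 2 * q) +
        q / (2 - 2 * q) * (z * (2 - 2 * q) / (2 - 3 * q))) ≤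
        (z + (q ^ 2 + q / 2)) * ((2 - 3 * q) / (2 - 2 * q) +
        q / (2 - 2 * q) * (z * (2 - 2 * q) / (2 - 3 * q))) := by gcongr
    linarith

/-- For larger `q` the weights stay frozen at their values for `q = 1/2` in
`exists_weights_of_le_half`. -/
lemma exists_weights_of_half_le {q : ℝ} (hq : 1 / 2 ≤ q) (hq2 : q ^ 2 + q / 2 < 1) :
    ∃ α β s c : ℝ, 0 < α ∧ 0 < β ∧ 0 < s ∧ 0 < c ∧ α + β = 1 ∧ s + c = 1 ∧ ∀ z : ℝ, 0 ≤ z →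
      z + q ^ 2 * max ((1 - z) / α) (z / β) ≤
        (z + (q ^ 2 + q / 2)) * (s + c * (z + q ^ 2 * max ((1 - z) / α) (z / β))) := by
  refine ⟨3 / 4, 1 / 4, 1 / 2, 1 / 2, by norm_num, by norm_num, by norm_num, by norm_num,
    by norm_num, by norm_num, fun z hz => ?_⟩
  have hq3 : 4 * q ^ 2 ≤ 3 := by nlinarith
  rcases le_total (z / (1 / 4)) ((1 - z) / (3 / 4)) with h | h
  · rw [max_eq_left h]
    have a0 : 0 ≤ (q - 1 / 2) ^ 2 * (q + 3 / 2) := by positivity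
    have a1 : 0 ≤ (1 - 4 * q ^ 2 / 3) * z ^ 2 := mul_nonneg (by linarith) (sq_nonneg z)
    have a2 : 0 ≤ z * (1 / 2 - (1 - 4 * q ^ 2 / 3) * (1 - (q ^ 2 + q / 2) / 2) + 2 * q ^ 2 / 3) := by
      apply mul_nonneg hz
      nlinarith [mul_nonneg (by linarith : (0:ℝ) ≤ 1 - 4 * q ^ 2 / 3) (by nlinarith : (0:ℝ) ≤ (q ^ 2 + q / 2) / 2)]
    nlinarith
  · rw [max_eq_right h]
    have b0 : 0 ≤ (q - 1 / 2) * (4 * q ^ 2 + 4 * q - 1) := mul_nonneg (by linarith) (by nlinarith)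
    have b1 : 0 ≤ (1 + 4 * q ^ 2) * (z - 1 / 2) ^ 2 := by positivity
    have b2 := mul_nonneg (mul_nonneg hz b0) (by linarith : (0:ℝ) ≤ q)
    nlinarith

lemma exists_weights {ε : ℝ} (hε : 0 < ε) (h1 : ε + 1 / 2 * Real.sqrt ε < 1) :
    ∃ α β s c : ℝ, 0 < α ∧ 0 < β ∧ 0 < s ∧ 0 < c ∧ α + β = 1 ∧ s + c = 1 ∧ ∀ z : ℝ, 0 ≤ z →
      z + ε * max ((1 - z) / α) (z / β) ≤
        (z + (ε + 1 / 2 * Real.sqrt ε)) * (s + c * (z + ε * max ((1 - z) / α) (z / β))) := by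
  obtain ⟨q, hq, rfl⟩ : ∃ q : ℝ, 0 < q ∧ ε = q ^ 2 :=
    ⟨Real.sqrt ε, Real.sqrt_pos.2 hε, (Real.sq_sqrt hε.le).symm⟩
  rw [Real.sqrt_sq hq.le, show 1 / 2 * q = q / 2 by ring] at *
  rcases le_total q (1 / 2) with h | h
  · exact exists_weights_of_le_half hq h
  · exact exists_weights_of_half_le h h1


/-! ### Positivity, trace and matrix units in block algebras. -/

section Positive

variable {ι : Type*} {n : ι → Type*}

lemma IsPos.add {x y : Alg n} (hx : IsPos x) (hy : IsPos y) : IsPos (x + y) :=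
  fun i => (hx i).add (hy i)

lemma isPos_zero : IsPos (0 : Alg n) := fun _ => Matrix.PosSemidef.zero

lemma IsPos.smul {x : Alg n} (hx : IsPos x) {r : ℝ} (hr : 0 ≤ r) : IsPos ((r : ℂ) • x) :=
  fun i => (hx i).smul (by exact_mod_cast hr)

lemma IsPos.star_eq {x : Alg n} (hx : IsPos x) : star x = x := funext fun i => (hx i).1

variable [∀ i, Fintype (n i)]

lemma IsPos.conj {x : Alg n} (hx : IsPos x) (y : Alg n) : IsPos (y * x * star y) :=
  fun i => (hx i).mul_mul_conjTranspose_same (y i)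

variable [Fintype ι]

lemma tr_add (x y : Alg n) : tr (x + y) = tr x + tr y := by
  simp [tr, Finset.sum_add_distrib]

lemma tr_sub (x y : Alg n) : tr (x - y) = tr x - tr y := by
  simp [tr, Finset.sum_sub_distrib]

lemma tr_smul (r : ℂ) (x : Alg n) : tr (r • x) = r * tr x := by
  simp [tr, Finset.mul_sum]

lemma tr_mul_comm (x y : Alg n) : tr (x * y) = tr (y * x) :=
  Finset.sum_congr rfl fun i _ => Matrix.trace_mul_comm (x i) (y i)

lemma IsPos.tr_nonneg {x : Alg n} (hx : IsPos x) : 0 ≤ tr x :=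
  Finset.sum_nonneg fun i _ => (hx i).trace_nonneg

lemma IsPos.tr_mul_nonneg {x y : Alg n} (hx : IsPos x) (hy : IsPos y) : 0 ≤ tr (x * y) := by
  classical
  refine Finset.sum_nonneg fun i _ => ?_
  obtain ⟨m, v, hv⟩ := Matrix.posSemidef_iff_eq_sum_vecMulVec.mp (hy i)
  rw [Pi.mul_apply, hv, Finset.mul_sum, Matrix.trace_sum]
  refine Finset.sum_nonneg fun j _ => ?_
  rw [Matrix.mul_vecMulVec, Matrix.trace_vecMulVec, dotProduct_comm]
  exact (hx i).dotProduct_mulVec_nonneg _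

end Positive

section Matrix

variable {m : Type*} [Fintype m]

lemma exists_conjTranspose_mul_self [DecidableEq m] {A : Matrix m m ℂ} (hA : A.PosSemidef) :
    ∃ B : Matrix m m ℂ, A = Bᴴ * B := by
  open scoped MatrixOrder in
  exact CStarAlgebra.nonneg_iff_eq_star_mul_self.mp hA.nonneg

end Matrix

section Expansion

variable {ι : Type*} [Fintype ι] [DecidableEq ι] {n : ι → Type*} [∀ i, Fintype (n i)]
  [∀ i, DecidableEq (n i)]

lemma sum_rotate {α β γ M : Type*} [Fintype α] [Fintype β] [Fintype γ] [AddCommMonoid M]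
    (f : α → β → γ → M) : ∑ a, ∑ b, ∑ c, f a b c = ∑ c, ∑ a, ∑ b, f a b c := by
  rw [Finset.sum_congr rfl fun a _ => Finset.sum_comm, Finset.sum_comm]

omit [Fintype ι] [∀ i, Fintype (n i)] in
lemma matUnit_apply_same (i : ι) (a b x y : n i) :
    (matUnit i a b : Alg n) i x y = if a = x ∧ b = y then 1 else 0 := by
  simp [matUnit, Matrix.single_apply]

lemma eq_sum_matUnit (x : Alg n) : x = ∑ i, ∑ a, ∑ b, x i a b • (matUnit i a b : Alg n) := by
  ext j u v
  simp only [Finset.sum_apply, Matrix.sum_apply, Pi.smul_apply, Matrix.smul_apply, smul_eq_mul]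
  rw [Finset.sum_eq_single j, Finset.sum_eq_single u, Finset.sum_eq_single v]
  · simp [matUnit_apply_same]
  · intro b _ hb; simp [matUnit_apply_same, hb]
  · simp
  · intro b _ hb; simp [matUnit_apply_same, hb]
  · simp
  · intro i _ hi
    simp [matUnit, Pi.single_eq_of_ne hi.symm]
  · simp

lemma map_eq_sum {M : Type*} [AddCommMonoid M] [Module ℂ M] (φ : Alg n →ₗ[ℂ] M) (x : Alg n) :
    φ x = ∑ i, ∑ a, ∑ b, x i a b • φ (matUnit i a b) := by
  conv_lhs => rw [eq_sum_matUnit x]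
  simp only [map_sum, map_smul]

end Expansion

/-! ### Choi matrices and complete positivity. -/

section Ampliation

variable {ι κ υ : Type*} [Fintype ι] [DecidableEq ι]
  {n : ι → Type*} [∀ i, Fintype (n i)] [∀ i, DecidableEq (n i)]
  {m : κ → Type*} {l : υ → Type*} {k : ℕ}

/-- The part of `P` in `|c⟩⟨d|` on the second tensor factor. -/
def slice (P : Alg (TensorShape n (Full k))) (c d : Fin k) : Alg n :=
  fun i => Matrix.of fun x y => P (i, ()) (x, c) (y, d)

lemma tensorMap_apply (φ : Alg n →ₗ[ℂ] Alg m) (ξ : Alg (Full k) →ₗ[ℂ] Alg l)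
    (P : Alg (TensorShape n (Full k))) (p : κ × υ) (X Y : m p.1 × l p.2) :
    tensorMap φ ξ P p X Y =
      ∑ c, ∑ d, φ (slice P c d) p.1 X.1 Y.1 * ξ (matUnit () c d) p.2 X.2 Y.2 := by
  have h : ∀ c d, φ (slice P c d) p.1 X.1 Y.1 =
      ∑ i, ∑ a, ∑ b, P (i, ()) (a, c) (b, d) * φ (matUnit i a b) p.1 X.1 Y.1 := by
    intro c d
    rw [map_eq_sum φ (slice P c d)]
    simp only [Finset.sum_apply, Matrix.sum_apply, Pi.smul_apply, Matrix.smul_apply, smul_eq_mul]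
    rfl
  simp only [h]
  simp only [tensorMap, LinearMap.coe_mk, AddHom.coe_mk, Finset.sum_apply, Matrix.sum_apply,
    Pi.smul_apply, Matrix.smul_apply, smul_eq_mul, tmul, Matrix.kroneckerMap_apply,
    Finset.univ_unique, Finset.sum_singleton, Finset.sum_mul, mul_assoc]
  symm
  rw [sum_rotate]
  refine Finset.sum_congr rfl fun i _ => ?_
  rw [sum_rotate]
  refine Finset.sum_congr rfl fun a _ => ?_
  rw [sum_rotate]

end Ampliation


section Contraction

variable {X Y Z : Type*} [Fintype X] [Fintype Y] [Fintype Z]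

lemma posSemidef_sum_blocks {K : Matrix (X × Z) (X × Z) ℂ} (hK : K.PosSemidef) :
    (Matrix.of fun x y => ∑ c, ∑ d, K (x, c) (y, d) : Matrix X X ℂ).PosSemidef := by
  classical
  convert hK.conjTranspose_mul_mul_same
    (Matrix.of fun (p : X × Z) (x : X) => if p.1 = x then (1 : ℂ) else 0) using 1
  ext x y
  simp only [Matrix.mul_apply, Matrix.conjTranspose_apply, Matrix.of_apply, Fintype.sum_prod_type]
  rw [Finset.sum_comm, Finset.sum_eq_single y]
  · refine Finset.sum_congr rfl fun d _ => ?_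
    rw [Finset.sum_eq_single x]
    · simp
    · intro b _ hb; simp [hb]
    · simp
  · intro b _ hb; simp [hb]
  · simp

/-- Restrict `A ⊗ B` to the diagonal copy of `Z`, then compress by the all-ones vector on `Z`.
Applying a map through its Choi matrix is such a contraction. -/
lemma posSemidef_contraction {A : Matrix (X × Z) (X × Z) ℂ} {B : Matrix (Y × Z) (Y × Z) ℂ}
    (hA : A.PosSemidef) (hB : B.PosSemidef) :
    (Matrix.of fun p q => ∑ c, ∑ d, A (p.1, c) (q.1, d) * B (p.2, c) (q.2, d) :
      Matrix (X × Y) (X × Y) ℂ).PosSemidef := by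
  classical
  have h := (hA.kronecker hB).submatrix
    fun p : (X × Y) × Z => ((p.1.1, p.2), (p.1.2, p.2))
  have h' := posSemidef_sum_blocks h
  simpa only [Matrix.submatrix_apply, Matrix.kroneckerMap_apply] using h'

end Contraction

section Choi

variable {ι κ υ : Type*} {n : ι → Type*} {m : κ → Type*} {l : υ → Type*} {k : ℕ}

/-- The Choi matrix of a map on a full matrix algebra. -/
def choi (φ : Alg (Full k) →ₗ[ℂ] Alg n) : Alg (TensorShape n (Full k)) :=
  fun p => Matrix.of fun X Y => φ (matUnit () X.2 Y.2) p.1 X.1 Y.1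

/-- The map with a given Choi matrix. -/
def ofChoi (C : Alg (TensorShape n (Full k))) : Alg (Full k) →ₗ[ℂ] Alg n where
  toFun x := fun i => Matrix.of fun a b => ∑ c, ∑ d, x () c d * C (i, ()) (a, c) (b, d)
  map_add' x y := by
    ext i a b
    simp [add_mul, Finset.sum_add_distrib]
  map_smul' r x := by
    ext i a b
    simp [mul_assoc, Finset.mul_sum]

lemma choi_ofChoi (C : Alg (TensorShape n (Full k))) : choi (ofChoi C) = C := by
  ext p X Y
  simp only [choi, ofChoi, LinearMap.coe_mk, AddHom.coe_mk, Matrix.of_apply, matUnit_apply_same]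
  rw [Finset.sum_eq_single X.2, Finset.sum_eq_single Y.2]
  · simp
  · intro b _ hb; simp [hb.symm]
  · simp
  · intro b _ hb; simp [hb.symm]
  · simp

lemma slice_choi (φ : Alg (Full k) →ₗ[ℂ] Alg n) (c d : Fin k) :
    slice (choi φ) c d = φ (matUnit () c d) := rfl

lemma choi_sub (φ ψ : Alg (Full k) →ₗ[ℂ] Alg n) : choi (φ - ψ) = choi φ - choi ψ := rfl

variable [Fintype ι] [DecidableEq ι] [∀ i, Fintype (n i)] [∀ i, DecidableEq (n i)]

variable (k) in
/-- The map `φ ⊗ id` with ancilla `ℂ^k`. -/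
abbrev stab (φ : Alg n →ₗ[ℂ] Alg m) :
    Alg (TensorShape n (Full k)) →ₗ[ℂ] Alg (TensorShape m (Full k)) :=
  tensorMap φ (LinearMap.id : Alg (Full k) →ₗ[ℂ] Alg (Full k))

lemma stab_apply (φ : Alg n →ₗ[ℂ] Alg m) (P : Alg (TensorShape n (Full k))) (p : κ × Unit)
    (X Y : m p.1 × Fin k) : stab k φ P p X Y = φ (slice P X.2 Y.2) p.1 X.1 Y.1 := by
  rw [stab, tensorMap_apply]
  rw [Finset.sum_eq_single X.2, Finset.sum_eq_single Y.2]
  · simp [matUnit_apply_same]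
  · intro b _ hb; simp [matUnit_apply_same, hb]
  · simp
  · intro b _ hb; simp [matUnit_apply_same, hb]
  · simp

lemma slice_stab (φ : Alg n →ₗ[ℂ] Alg m) (P : Alg (TensorShape n (Full k))) (c d : Fin k) :
    slice (stab k φ P) c d = φ (slice P c d) := by
  ext j x y
  exact stab_apply φ P (j, ()) (x, c) (y, d)

lemma ext_slice {P Q : Alg (TensorShape m (Full k))} (h : ∀ c d, slice P c d = slice Q c d) :
    P = Q := by
  ext ⟨j, u⟩ ⟨x, c⟩ ⟨y, d⟩
  exact congrFun (congrFun (congrFun (h c d) j) x) y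

lemma choi_comp (φ : Alg n →ₗ[ℂ] Alg m) (β : Alg (Full k) →ₗ[ℂ] Alg n) :
    choi (φ ∘ₗ β) = stab k φ (choi β) :=
  ext_slice fun c d => by rw [slice_stab, slice_choi, slice_choi]; rfl

/-- Thus `ξ` is a post-processing common to `Φ ⊗ id` and `Ψ ⊗ id`. -/
lemma tensorMap_eq_comp [Fintype κ] [DecidableEq κ] [∀ i, Fintype (m i)] [∀ i, DecidableEq (m i)]
    (φ : Alg n →ₗ[ℂ] Alg m) (ξ : Alg (Full k) →ₗ[ℂ] Alg l) (P : Alg (TensorShape n (Full k))) :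
    tensorMap φ ξ P = tensorMap (LinearMap.id : Alg m →ₗ[ℂ] Alg m) ξ (stab k φ P) := by
  ext p X Y
  rw [tensorMap_apply, tensorMap_apply]
  simp only [slice_stab, LinearMap.id_apply]

end Choi

section CP

variable {ι κ : Type*} [Fintype ι] [DecidableEq ι] {n : ι → Type*}
  [∀ i, Fintype (n i)] [∀ i, DecidableEq (n i)] {m : κ → Type*} {k : ℕ}

lemma IsCP.isPos_choi [Fintype κ] [DecidableEq κ] [∀ i, DecidableEq (m i)]
    {φ : Alg (Full k) →ₗ[ℂ] Alg m} (h : IsCP φ) : IsPos (choi φ) := by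
  -- The unnormalised maximally entangled vector; `φ ⊗ id` sends its projection to the Choi matrix.
  let v : Fin k × Fin k → ℂ := fun p => if p.1 = p.2 then 1 else 0
  have hx : IsPos (fun _ => Matrix.vecMulVec v (star v) : Alg (TensorShape (Full k) (Full k))) :=
    fun _ => Matrix.posSemidef_vecMulVec_self_star v
  convert h k _ hx using 1
  refine ext_slice fun c d => ?_
  rw [slice_choi, slice_stab]
  congr 1
  ext u a b
  rw [matUnit_apply_same]
  simp [slice, Matrix.vecMulVec_apply, v, apply_ite, ← ite_and, eq_comm, and_comm]

lemma IsPos.isCP_of_choi [Fintype κ] [DecidableEq κ] [∀ i, Fintype (m i)] [∀ i, DecidableEq (m i)]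
    {φ : Alg (Full k) →ₗ[ℂ] Alg m} (h : IsPos (choi φ)) : IsCP φ := by
  intro r x hx p
  have hx' := (hx ((), ())).submatrix (Prod.swap : Fin r × Fin k → Fin k × Fin r)
  convert posSemidef_contraction (h (p.1, ())) hx' using 1
  ext X Y
  rw [stab_apply, map_eq_sum φ]
  simp [Finset.sum_apply, Matrix.sum_apply, slice, choi, mul_comm]

lemma isCP_iff_isPos_choi [Fintype κ] [DecidableEq κ] [∀ i, Fintype (m i)] [∀ i, DecidableEq (m i)]
    {φ : Alg (Full k) →ₗ[ℂ] Alg m} : IsCP φ ↔ IsPos (choi φ) :=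
  ⟨IsCP.isPos_choi, IsPos.isCP_of_choi⟩

lemma IsCP.isPos_tensorMap_id {r : ℕ} {ξ : Alg (Full k) →ₗ[ℂ] Alg (Full r)} (hξ : IsCP ξ)
    {P : Alg (TensorShape n (Full k))} (hP : IsPos P) :
    IsPos (tensorMap (LinearMap.id : Alg n →ₗ[ℂ] Alg n) ξ P) := by
  intro p
  convert posSemidef_contraction (hP (p.1, ())) (hξ.isPos_choi ((), ())) using 1
  ext X Y
  rw [tensorMap_apply]
  rfl

end CP

/-! ### Operators on the ancilla, marginals, and channels via Choi matrices. -/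

section Ampliation

variable {ι κ : Type*} {n : ι → Type*} [∀ i, DecidableEq (n i)] {m : κ → Type*} {k : ℕ}

/-- The element `1 ⊗ K`. -/
def amp (K : Matrix (Fin k) (Fin k) ℂ) : Alg (TensorShape n (Full k)) :=
  fun p => Matrix.kroneckerMap (fun s t : ℂ => s * t) (1 : Matrix (n p.1) (n p.1) ℂ) K

lemma amp_add (K L : Matrix (Fin k) (Fin k) ℂ) :
    (amp (K + L) : Alg (TensorShape n (Full k))) = amp K + amp L := by
  ext p X Y; simp [amp, mul_add]

lemma amp_sub (K L : Matrix (Fin k) (Fin k) ℂ) :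
    (amp (K - L) : Alg (TensorShape n (Full k))) = amp K - amp L := by
  ext p X Y; simp [amp, mul_sub]

lemma amp_smul (r : ℂ) (K : Matrix (Fin k) (Fin k) ℂ) :
    (amp (r • K) : Alg (TensorShape n (Full k))) = r • amp K := by
  ext p X Y; simp [amp]; ring

lemma amp_one : (amp 1 : Alg (TensorShape n (Full k))) = 1 :=
  funext fun _ => Matrix.one_kronecker_one

lemma star_amp (K : Matrix (Fin k) (Fin k) ℂ) :
    star (amp K : Alg (TensorShape n (Full k))) = amp Kᴴ := by
  funext p
  ext X Y
  by_cases h : X.1 = Y.1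
  · simp [amp, Matrix.one_apply, h]
  · simp [amp, h, Ne.symm h]

variable [∀ i, Fintype (n i)]

lemma amp_mul (K L : Matrix (Fin k) (Fin k) ℂ) :
    (amp (K * L) : Alg (TensorShape n (Full k))) = amp K * amp L := by
  funext p
  have := Matrix.mul_kronecker_mul (1 : Matrix (n p.1) (n p.1) ℂ) (1 : Matrix (n p.1) (n p.1) ℂ) K L
  rw [mul_one] at this
  exact this

lemma slice_amp_mul (K : Matrix (Fin k) (Fin k) ℂ) (P : Alg (TensorShape n (Full k)))
    (c d : Fin k) : slice (amp K * P) c d = ∑ c', K c c' • slice P c' d := by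
  ext i x y
  simp [slice, amp, Matrix.mul_apply, Fintype.sum_prod_type, Matrix.one_apply,
    Finset.sum_apply, Matrix.sum_apply]

lemma slice_mul_amp (K : Matrix (Fin k) (Fin k) ℂ) (P : Alg (TensorShape n (Full k)))
    (c d : Fin k) : slice (P * amp K) c d = ∑ d', K d' d • slice P c d' := by
  ext i x y
  simp [slice, amp, Matrix.mul_apply, Fintype.sum_prod_type, Matrix.one_apply,
    Finset.sum_apply, Matrix.sum_apply, mul_comm]

lemma IsPos.amp_conj {P : Alg (TensorShape n (Full k))} (hP : IsPos P)
    (K : Matrix (Fin k) (Fin k) ℂ) : IsPos (amp K * P * amp Kᴴ) := by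
  rw [← star_amp]; exact hP.conj _

variable [Fintype ι] [DecidableEq ι] [∀ i, Fintype (m i)] [∀ i, DecidableEq (m i)]

lemma stab_amp_mul (φ : Alg n →ₗ[ℂ] Alg m) (K : Matrix (Fin k) (Fin k) ℂ)
    (P : Alg (TensorShape n (Full k))) : stab k φ (amp K * P) = amp K * stab k φ P :=
  ext_slice fun c d => by
    rw [slice_stab, slice_amp_mul, slice_amp_mul, map_sum]
    simp only [map_smul, slice_stab]

lemma stab_mul_amp (φ : Alg n →ₗ[ℂ] Alg m) (K : Matrix (Fin k) (Fin k) ℂ)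
    (P : Alg (TensorShape n (Full k))) : stab k φ (P * amp K) = stab k φ P * amp K :=
  ext_slice fun c d => by
    rw [slice_stab, slice_mul_amp, slice_mul_amp, map_sum]
    simp only [map_smul, slice_stab]

end Ampliation

section Marginal

variable {ι κ : Type*} [Fintype ι] {n : ι → Type*} [∀ i, Fintype (n i)] {k : ℕ}

/-- The marginal on the ancilla `ℂ^k`. -/
def marg : Alg (TensorShape n (Full k)) →ₗ[ℂ] Matrix (Fin k) (Fin k) ℂ where
  toFun P := Matrix.of fun c d => tr (slice P c d)
  map_add' P Q := by
    ext c d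
    exact tr_add (slice P c d) (slice Q c d)
  map_smul' r P := by
    ext c d
    exact tr_smul r (slice P c d)

lemma marg_apply (P : Alg (TensorShape n (Full k))) (c d : Fin k) :
    marg P c d = tr (slice P c d) := rfl

lemma trace_marg (P : Alg (TensorShape n (Full k))) : (marg P).trace = tr P := by
  simp only [Matrix.trace, Matrix.diag, marg_apply, tr, slice, Matrix.of_apply,
    Fintype.sum_prod_type, Finset.univ_unique, Finset.sum_singleton]
  rw [Finset.sum_comm]
  refine Finset.sum_congr rfl fun i _ => ?_
  rw [Finset.sum_comm]

lemma IsPos.marg {P : Alg (TensorShape n (Full k))} (hP : IsPos P) : (marg P).PosSemidef := by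
  have : ChannelComparison.marg P = ∑ i, ∑ x, (P (i, ())).submatrix (Prod.mk x) (Prod.mk x) := by
    ext c d
    simp [marg_apply, tr, slice, Matrix.trace, Matrix.sum_apply]
  rw [this]
  exact Matrix.posSemidef_sum _ fun i _ => Matrix.posSemidef_sum _ fun x _ =>
    (hP (i, ())).submatrix _

lemma tr_sum {α : Type*} (s : Finset α) (f : α → Alg n) : tr (∑ a ∈ s, f a) = ∑ a ∈ s, tr (f a) := by
  classical
  induction s using Finset.induction_on with
  | empty => simp [tr]
  | insert a s ha h => rw [Finset.sum_insert ha, Finset.sum_insert ha, tr_add, h]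

variable [∀ i, DecidableEq (n i)]

lemma marg_amp_mul (K : Matrix (Fin k) (Fin k) ℂ) (P : Alg (TensorShape n (Full k))) :
    marg (amp K * P) = K * marg P := by
  ext c d
  simp only [marg_apply, slice_amp_mul, tr_sum, tr_smul, Matrix.mul_apply]

lemma marg_mul_amp (K : Matrix (Fin k) (Fin k) ℂ) (P : Alg (TensorShape n (Full k))) :
    marg (P * amp K) = marg P * K := by
  ext c d
  simp only [marg_apply, slice_mul_amp, tr_sum, tr_smul, Matrix.mul_apply, mul_comm]

variable [DecidableEq ι] [Fintype κ] {m : κ → Type*} [∀ i, Fintype (m i)]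

lemma marg_stab {φ : Alg n →ₗ[ℂ] Alg m} (h : ∀ x, tr (φ x) = tr x)
    (P : Alg (TensorShape n (Full k))) : marg (stab k φ P) = marg P := by
  ext c d
  rw [marg_apply, slice_stab, h, marg_apply]

lemma tr_stab {φ : Alg n →ₗ[ℂ] Alg m} (h : ∀ x, tr (φ x) = tr x)
    (P : Alg (TensorShape n (Full k))) : tr (stab k φ P) = tr P := by
  rw [← trace_marg, marg_stab h, trace_marg]

end Marginal

section Channel

variable {κ : Type*} [Fintype κ] [DecidableEq κ] {m : κ → Type*} [∀ i, Fintype (m i)]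
  [∀ i, DecidableEq (m i)] {k : ℕ}

lemma isChannel_iff {φ : Alg (Full k) →ₗ[ℂ] Alg m} :
    IsChannel φ ↔ IsPos (choi φ) ∧ marg (choi φ) = 1 := by
  rw [IsChannel, isCP_iff_isPos_choi]
  refine and_congr_right fun _ => ⟨fun h => ?_, fun h x => ?_⟩
  · ext c d
    rw [marg_apply, slice_choi, h]
    rcases eq_or_ne c d with rfl | hcd
    · simp [tr, Matrix.trace, matUnit]
    · simp [tr, matUnit, hcd]
  · rw [map_eq_sum φ x]
    have h' : ∀ c d, tr (φ (matUnit () c d)) = (1 : Matrix (Fin k) (Fin k) ℂ) c d := by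
      intro c d
      rw [← h]; rfl
    simp only [tr_sum, tr_smul, h']
    simp [Matrix.one_apply, tr, Matrix.trace]

end Channel


/-! ### Spectral bounds and compactness. -/

section Spectral

variable {m : Type*} [Fintype m] [DecidableEq m]

lemma exists_unitary_diagonalization {A : Matrix m m ℂ} (hA : A.IsHermitian) :
    ∃ U : Matrix m m ℂ, U * Uᴴ = 1 ∧ Uᴴ * U = 1 ∧
      A = U * diagonal (fun i => (hA.eigenvalues i : ℂ)) * Uᴴ := by
  refine ⟨hA.eigenvectorUnitary, ?_, ?_, ?_⟩
  · exact (Matrix.mem_unitaryGroup_iff).1 hA.eigenvectorUnitary.2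
  · exact (Matrix.mem_unitaryGroup_iff').1 hA.eigenvectorUnitary.2
  · exact hA.spectral_theorem

/-- Supplies the second-order correction that restores the marginal in
`exists_optimal_choi_and_dual`. -/
lemma posSemidef_trace_smul_sub {A : Matrix m m ℂ} (hA : A.PosSemidef) :
    ((A.trace.re : ℂ) • (1 : Matrix m m ℂ) - A).PosSemidef := by
  obtain ⟨U, hU, hU', h⟩ := exists_unitary_diagonalization hA.1
  have e : (A.trace.re : ℂ) • (1 : Matrix m m ℂ) - A =
      U * diagonal (fun i => ((A.trace.re - hA.1.eigenvalues i : ℝ) : ℂ)) * Uᴴ := by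
    have : diagonal (fun i => ((A.trace.re - hA.1.eigenvalues i : ℝ) : ℂ)) =
        (A.trace.re : ℂ) • (1 : Matrix m m ℂ) - diagonal (fun i => (hA.1.eigenvalues i : ℂ)) := by
      ext i j
      rcases eq_or_ne i j with rfl | hij
      · simp
      · simp [hij]
    rw [this, mul_sub, sub_mul, ← h]
    simp [hU]
  rw [e]
  refine Matrix.PosSemidef.mul_mul_conjTranspose_same (Matrix.PosSemidef.diagonal fun i => ?_) U
  have : A.trace.re = ∑ j, hA.1.eigenvalues j := by
    rw [hA.1.trace_eq_sum_eigenvalues]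
    simp
  simp only [Pi.zero_apply]
  rw [this]
  exact_mod_cast sub_nonneg.2 (Finset.single_le_sum (fun j _ => hA.eigenvalues_nonneg j)
    (Finset.mem_univ i))

lemma norm_apply_le_trace {A : Matrix m m ℂ} (hA : A.PosSemidef) (x y : m) :
    ‖A x y‖ ≤ A.trace.re := by
  obtain ⟨B, rfl⟩ := exists_conjTranspose_mul_self hA
  have ht : (Bᴴ * B).trace.re = ∑ z, ∑ w, ‖B z w‖ ^ 2 := by
    rw [Finset.sum_comm]
    simp [Matrix.trace, Matrix.mul_apply, ← Complex.normSq_eq_norm_sq, Complex.normSq_apply]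
  rw [ht, Matrix.mul_apply]
  refine (norm_sum_le _ _).trans (Finset.sum_le_sum fun z _ => ?_)
  rw [norm_mul, Matrix.conjTranspose_apply, norm_star]
  have hx := Finset.single_le_sum (f := fun w => ‖B z w‖ ^ 2) (fun w _ => sq_nonneg _)
    (Finset.mem_univ x)
  have hy := Finset.single_le_sum (f := fun w => ‖B z w‖ ^ 2) (fun w _ => sq_nonneg _)
    (Finset.mem_univ y)
  nlinarith [sq_nonneg (‖B z x‖ - ‖B z y‖)]

lemma exists_trace_eq (f : Matrix m m ℂ →ₗ[ℂ] ℂ) :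
    ∃ T : Matrix m m ℂ, ∀ K, f K = (T * K).trace := by
  refine ⟨Matrix.of fun c d => f (Matrix.single d c 1), fun K => ?_⟩
  conv_lhs => rw [Matrix.matrix_eq_sum_single K]
  simp only [map_sum, Matrix.trace, Matrix.diag, Matrix.mul_apply, Matrix.of_apply]
  rw [Finset.sum_comm]
  refine Finset.sum_congr rfl fun a _ => Finset.sum_congr rfl fun b _ => ?_
  rw [show Matrix.single b a (K b a) = K b a • Matrix.single b a (1 : ℂ) by
    rw [Matrix.smul_single, smul_eq_mul, mul_one], map_smul, smul_eq_mul, mul_comm]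

lemma exists_isHermitian_re_trace_eq (f : Matrix m m ℂ →ₗ[ℂ] ℂ) :
    ∃ T : Matrix m m ℂ, T.IsHermitian ∧ ∀ K : Matrix m m ℂ, K.IsHermitian →
      (f K).re = (T * K).trace.re := by
  obtain ⟨T, hT⟩ := exists_trace_eq f
  refine ⟨(1 / 2 : ℝ) • (T + Tᴴ), ?_, fun K hK => ?_⟩
  · rw [Matrix.IsHermitian, Matrix.conjTranspose_smul, Matrix.conjTranspose_add,
      Matrix.conjTranspose_conjTranspose, add_comm Tᴴ]
    simp
  · have h : (Tᴴ * K).trace = star (T * K).trace := by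
      rw [← Matrix.trace_conjTranspose, Matrix.conjTranspose_mul, hK.eq, Matrix.trace_mul_comm]
    rw [hT, Matrix.smul_mul, Matrix.trace_smul, add_mul, Matrix.trace_add, h]
    simp
    ring

end Spectral

section Compact

variable {ι : Type*} {n : ι → Type*} [∀ i, Fintype (n i)]

lemma isClosed_isPos : IsClosed {P : Alg n | IsPos P} := by
  have : {P : Alg n | IsPos P} = ⋂ i, {P : Alg n | (P i)ᴴ = P i} ∩
      ⋂ x : n i → ℂ, {P : Alg n | 0 ≤ star x ⬝ᵥ (P i *ᵥ x)} := by
    ext P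
    simp only [IsPos, Matrix.posSemidef_iff_dotProduct_mulVec, Set.mem_iInter, Set.mem_inter_iff,
      Set.mem_ofPred_eq, Matrix.IsHermitian]
  rw [this]
  refine isClosed_iInter fun i => IsClosed.inter (isClosed_eq ?_ ?_) (isClosed_iInter fun x =>
    isClosed_le continuous_const ?_)
  · fun_prop
  · fun_prop
  · simp only [dotProduct, Matrix.mulVec]
    fun_prop

variable [Fintype ι]

lemma continuous_tr : Continuous (tr : Alg n → ℂ) := by
  change Continuous fun x : Alg n => ∑ i, ∑ a, x i a a
  fun_prop

lemma isCompact_isPos_tr_le (c : ℝ) : IsCompact {P : Alg n | IsPos P ∧ (tr P).re ≤ c} := by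
  classical
  have hK : IsCompact (Set.univ.pi fun i => (Set.univ.pi fun _ : n i => Set.univ.pi fun _ : n i =>
      Metric.closedBall (0 : ℂ) c) : Set (∀ i, n i → n i → ℂ)) :=
    isCompact_univ_pi fun i => isCompact_univ_pi fun x => isCompact_univ_pi fun y =>
      isCompact_closedBall _ _
  refine hK.of_isClosed_subset ?_ ?_
  · exact isClosed_isPos.inter (isClosed_le (Complex.continuous_re.comp continuous_tr)
      continuous_const)
  · intro (P : Alg n) ⟨hP, hc⟩ i _ x _ y _
    rw [mem_closedBall_zero_iff]
    refine (norm_apply_le_trace (hP i) x y).trans (le_trans ?_ hc)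
    rw [show (tr P).re = ∑ i, (P i).trace.re from Complex.re_sum _ _]
    exact Finset.single_le_sum (f := fun i => (P i).trace.re)
      (fun j _ => (Complex.le_def.1 (hP j).trace_nonneg).1) (Finset.mem_univ i)

end Compact

/-! ### Semidefinite duality for Choi matrices. -/

section Duality

variable {ι : Type*} [Fintype ι] {n : ι → Type*} [∀ i, Fintype (n i)]
  [∀ i, DecidableEq (n i)] {k : ℕ}

omit [∀ i, DecidableEq (n i)] in
lemma continuous_functional (g : Alg n →ₗ[ℂ] ℂ) : Continuous g :=
  LinearMap.continuous_of_finiteDimensional g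

omit [∀ i, DecidableEq (n i)] in
lemma isCompact_isPos_marg_eq_one :
    IsCompact {C : Alg (TensorShape n (Full k)) | IsPos C ∧ marg C = 1} := by
  refine IsCompact.of_isClosed_subset (isCompact_isPos_tr_le k) ?_ ?_
  · refine isClosed_isPos.inter (isClosed_eq ?_ continuous_const)
    exact LinearMap.continuous_of_finiteDimensional marg
  · rintro C ⟨hC, h⟩
    refine ⟨hC, ?_⟩
    rw [← trace_marg, h]
    simp

/-- No separation theorem is needed: the dual optimum `T` is read off from a primal maximiser `C` as
the Lagrange multiplier, represented by `K ↦ ½ g(KC + CK)`, and its feasibility is the first-order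
optimality condition at `C`. -/
theorem exists_optimal_choi_and_dual (g : Alg (TensorShape n (Full k)) →ₗ[ℂ] ℂ)
    (hg : ∀ P, IsPos P → 0 ≤ (g P).re)
    (h0 : ∃ C : Alg (TensorShape n (Full k)), IsPos C ∧ marg C = 1) :
    ∃ (C : Alg (TensorShape n (Full k))) (T : Matrix (Fin k) (Fin k) ℂ),
      IsPos C ∧ marg C = 1 ∧ (∀ C', IsPos C' → marg C' = 1 → (g C').re ≤ (g C).re) ∧
      T.IsHermitian ∧ T.trace.re = (g C).re ∧
      ∀ P, IsPos P → (g P).re ≤ (T * marg P).trace.re := by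
  obtain ⟨C, ⟨hC, hC1⟩, hmax⟩ := (isCompact_isPos_marg_eq_one (n := n) (k := k)).exists_isMaxOn h0
    (Complex.continuous_re.comp (continuous_functional g)).continuousOn
  have hmax' : ∀ C', IsPos C' → marg C' = 1 → (g C').re ≤ (g C).re :=
    fun C' h h' => hmax ⟨h, h'⟩
  let f : Matrix (Fin k) (Fin k) ℂ →ₗ[ℂ] ℂ :=
    { toFun := fun K => (1 / 2 : ℂ) * g (amp K * C + C * amp K)
      map_add' := fun K L => by
        rw [← mul_add, ← map_add, amp_add]; congr 2; noncomm_ring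
      map_smul' := fun r K => by
        rw [amp_smul, smul_mul_assoc, mul_smul_comm, ← smul_add, map_smul]
        simp only [smul_eq_mul, RingHom.id_apply]; ring }
  obtain ⟨T, hT, hTf⟩ := exists_isHermitian_re_trace_eq f
  refine ⟨C, T, hC, hC1, hmax', hT, ?_, fun P hP => ?_⟩
  · have := hTf 1 Matrix.isHermitian_one
    rw [mul_one] at this
    rw [← this]
    simp only [f, LinearMap.coe_mk, AddHom.coe_mk, amp_one, one_mul, mul_one, ← two_smul ℂ C,
      map_smul, smul_eq_mul]
    congr 1
    ring
  · have hPm := hP.marg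
    rw [← hTf _ hPm.1]
    set K : Matrix (Fin k) (Fin k) ℂ := (1 / 2 : ℂ) • marg P with hK
    have hKh : Kᴴ = K := by
      rw [hK, Matrix.conjTranspose_smul, hPm.1.eq]; simp
    have hKK : (K * K).PosSemidef := by
      have := Matrix.posSemidef_conjTranspose_mul_self K
      rwa [hKh] at this
    set c := (K * K).trace.re
    have hc : 0 ≤ c := (Complex.le_def.1 hKK.trace_nonneg).1
    obtain ⟨B, hB⟩ := exists_conjTranspose_mul_self (posSemidef_trace_smul_sub hKK)
    set H : Alg (TensorShape n (Full k)) := amp K with hH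
    have hHs : star H = H := by rw [hH, star_amp, hKh]
    have hfP : (f (marg P)).re = (g (H * C + C * H)).re := by
      have : marg P = (2 : ℂ) • K := by rw [hK, smul_smul]; norm_num
      rw [this, map_smul]
      simp only [f, LinearMap.coe_mk, AddHom.coe_mk, smul_eq_mul, ← mul_assoc]
      norm_num [hH]
    rw [hfP]
    have hv : 0 ≤ (g C).re := hg C hC
    have key : ∀ t : ℝ, 0 < t →
        (g P).re - (g (H * C + C * H)).re ≤ t * (c * (g C).re) := by
      intro t ht
      -- Moves from `C` in the direction `P`. The marginal is `(1 - tK)² + 2tK + t²(c - K²) = 1 +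
      -- t²c`, so `Q` becomes feasible after rescaling, and the cost of rescaling is of second order
      -- in `t`.
      let Q := (1 - (t : ℂ) • H) * C * star (1 - (t : ℂ) • H) + (t : ℂ) • P +
        ((t ^ 2 : ℝ) : ℂ) • (amp Bᴴ * C * amp Bᴴᴴ)
      have hQ : IsPos Q := ((hC.conj _).add (hP.smul ht.le)).add
        ((hC.amp_conj _).smul (by positivity))
      have hs : star (1 - (t : ℂ) • H) = 1 - (t : ℂ) • H := by
        rw [star_sub, star_one, star_smul, hHs]; simp
      have hQm : marg Q = ((1 + t ^ 2 * c : ℝ) : ℂ) • (1 : Matrix (Fin k) (Fin k) ℂ) := by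
        have e1 : (1 - (t : ℂ) • H) = amp (1 - (t : ℂ) • K) := by
          rw [amp_sub, amp_one, amp_smul]
        have e2 : marg P = (2 : ℂ) • K := by rw [hK, smul_smul]; norm_num
        simp only [Q]
        rw [hs, e1, map_add, map_add, map_smul, map_smul, marg_mul_amp, marg_amp_mul,
          marg_mul_amp, marg_amp_mul, hC1, mul_one, mul_one, Matrix.conjTranspose_conjTranspose,
          ← hB, e2]
        rw [mul_sub, sub_mul, sub_mul]
        simp only [mul_one, one_mul, smul_mul_assoc, mul_smul_comm, smul_smul, smul_sub]
        push_cast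
        module
      have hpos : (0 : ℝ) < 1 + t ^ 2 * c := by positivity
      have h1 := hmax' ((((1 + t ^ 2 * c)⁻¹ : ℝ) : ℂ) • Q) (hQ.smul (by positivity)) (by
        rw [map_smul, hQm, smul_smul, ← Complex.ofReal_mul, inv_mul_cancel₀ hpos.ne']
        simp)
      rw [map_smul, smul_eq_mul, Complex.re_ofReal_mul, inv_mul_le_iff₀ hpos] at h1
      have h2 : Q = C - (t : ℂ) • (H * C + C * H) + ((t ^ 2 : ℝ) : ℂ) • (H * C * star H) +
          (t : ℂ) • P + ((t ^ 2 : ℝ) : ℂ) • (amp Bᴴ * C * amp Bᴴᴴ) := by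
        simp only [Q]
        rw [hs, hHs]
        simp only [mul_sub, sub_mul, mul_one, one_mul, smul_mul_assoc, mul_smul_comm,
          smul_add]
        push_cast
        module
      rw [h2] at h1
      simp only [map_add, map_sub, map_smul, smul_eq_mul, Complex.add_re, Complex.sub_re,
        Complex.re_ofReal_mul] at h1
      have h3 := hg _ (hC.conj H)
      have h4 := hg _ (hC.amp_conj Bᴴ)
      simp only [map_add, Complex.add_re]
      have h5 : 0 ≤ t ^ 2 * (g (H * C * star H)).re := by positivity
      have h6 : 0 ≤ t ^ 2 * (g (amp Bᴴ * C * amp Bᴴᴴ)).re := by positivity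
      nlinarith
    have := le_of_forall_pos_le_add (a := (g P).re - (g (H * C + C * H)).re) (b := 0)
      fun δ hδ => by
        have hcv : 0 ≤ c * (g C).re := mul_nonneg hc hv
        refine (key (δ / (c * (g C).re + 1)) (by positivity)).trans ?_
        rw [zero_add, div_mul_eq_mul_div, div_le_iff₀ (by positivity)]
        nlinarith
    linarith

end Duality


/-! ### Effects, diagonal weights and the harmonic mean bound. -/

section Functionals

variable {ι : Type*} [Fintype ι] {n : ι → Type*} [∀ i, Fintype (n i)]
  [∀ i, DecidableEq (n i)] {k : ℕ}

/-- Effects: functionals between zero and the trace. -/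
def IsEffect (g : Alg n →ₗ[ℂ] ℂ) : Prop :=
  ∀ P, IsPos P → 0 ≤ (g P).re ∧ (g P).re ≤ (tr P).re

/-- The map `P ↦ (1 ⊗ K) P (1 ⊗ L)`. -/
def ampConj (K L : Matrix (Fin k) (Fin k) ℂ) :
    Alg (TensorShape n (Full k)) →ₗ[ℂ] Alg (TensorShape n (Full k)) where
  toFun P := amp K * P * amp L
  map_add' P Q := by rw [mul_add, add_mul]
  map_smul' r P := by rw [mul_smul_comm, smul_mul_assoc]; rfl

omit [Fintype ι] in
lemma ampConj_apply (K L : Matrix (Fin k) (Fin k) ℂ) (P : Alg (TensorShape n (Full k))) :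
    ampConj K L P = amp K * P * amp L := rfl

omit [Fintype ι] in
lemma ampConj_ampConj (K L K' L' : Matrix (Fin k) (Fin k) ℂ) (P : Alg (TensorShape n (Full k))) :
    ampConj K L (ampConj K' L' P) = ampConj (K * K') (L' * L) P := by
  simp only [ampConj_apply, amp_mul, mul_assoc]

omit [Fintype ι] in
lemma ampConj_one (P : Alg (TensorShape n (Full k))) : ampConj 1 1 P = P := by
  rw [ampConj_apply, amp_one, one_mul, mul_one]

lemma marg_ampConj (K L : Matrix (Fin k) (Fin k) ℂ) (P : Alg (TensorShape n (Full k))) :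
    marg (ampConj K L P) = K * marg P * L := by
  rw [ampConj_apply, marg_mul_amp, marg_amp_mul]

omit [Fintype ι] in
lemma IsPos.ampConj {P : Alg (TensorShape n (Full k))} (hP : IsPos P)
    (K : Matrix (Fin k) (Fin k) ℂ) : IsPos (ampConj K Kᴴ P) := hP.amp_conj K

lemma stab_ampConj [DecidableEq ι] {κ : Type*} {m : κ → Type*} [∀ i, Fintype (m i)]
    [∀ i, DecidableEq (m i)] (φ : Alg n →ₗ[ℂ] Alg m) (K L : Matrix (Fin k) (Fin k) ℂ)
    (P : Alg (TensorShape n (Full k))) :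
    stab k φ (ampConj K L P) = ampConj K L (stab k φ P) := by
  rw [ampConj_apply, ampConj_apply, stab_mul_amp, stab_amp_mul]

/-- A real diagonal matrix. -/
def realDiag (d : Fin k → ℝ) : Matrix (Fin k) (Fin k) ℂ := diagonal fun i => (d i : ℂ)

lemma realDiag_conjTranspose (d : Fin k → ℝ) : (realDiag d)ᴴ = realDiag d := by
  rw [realDiag, Matrix.diagonal_conjTranspose]
  congr 1
  ext i
  simp

omit [Fintype ι] in
lemma IsPos.ampConj_realDiag {P : Alg (TensorShape n (Full k))} (hP : IsPos P) (d : Fin k → ℝ) :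
    IsPos (ChannelComparison.ampConj (realDiag d) (realDiag d) P) := by
  simpa only [realDiag_conjTranspose] using hP.ampConj (realDiag d)

lemma realDiag_mul (d e : Fin k → ℝ) : realDiag d * realDiag e = realDiag fun i => d i * e i := by
  simp [realDiag]

lemma realDiag_one : realDiag (fun _ : Fin k => (1 : ℝ)) = 1 := by
  simp [realDiag]

omit [∀ i, DecidableEq (n i)] in
/-- The weighted sum of the diagonal entries of the marginal. -/
def wsum (w : Fin k → ℝ) (P : Alg (TensorShape n (Full k))) : ℝ := ∑ i, w i * (marg P i i).re

lemma re_trace_realDiag_mul (w : Fin k → ℝ) (M : Matrix (Fin k) (Fin k) ℂ) :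
    (realDiag w * M).trace.re = ∑ i, w i * (M i i).re := by
  simp [realDiag, Matrix.trace, Matrix.diagonal_mul]

omit [∀ i, DecidableEq (n i)] in
lemma re_tr_eq_wsum (P : Alg (TensorShape n (Full k))) : (tr P).re = wsum (fun _ => 1) P := by
  rw [← trace_marg]
  simp [Matrix.trace, wsum]

omit [∀ i, DecidableEq (n i)] in
lemma IsPos.wsum_mono {P : Alg (TensorShape n (Full k))} (hP : IsPos P) {v w : Fin k → ℝ}
    (h : ∀ i, v i ≤ w i) : wsum v P ≤ wsum w P :=
  Finset.sum_le_sum fun i _ => mul_le_mul_of_nonneg_right (h i)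
    (Complex.le_def.1 hP.marg.diag_nonneg).1

lemma wsum_ampConj (d w : Fin k → ℝ) (P : Alg (TensorShape n (Full k))) :
    wsum w (ampConj (realDiag d) (realDiag d) P) = wsum (fun i => w i * d i ^ 2) P := by
  refine Finset.sum_congr rfl fun i _ => ?_
  rw [marg_ampConj]
  simp [realDiag, Matrix.diagonal_mul, Matrix.mul_diagonal]
  ring

omit [∀ i, DecidableEq (n i)] in
lemma wsum_add (v w : Fin k → ℝ) (P : Alg (TensorShape n (Full k))) :
    wsum v P + wsum w P = wsum (fun i => v i + w i) P := by
  simp [wsum, ← Finset.sum_add_distrib, add_mul]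

omit [∀ i, DecidableEq (n i)] in
lemma mul_wsum (r : ℝ) (w : Fin k → ℝ) (P : Alg (TensorShape n (Full k))) :
    r * wsum w P = wsum (fun i => r * w i) P := by
  simp [wsum, Finset.mul_sum, mul_assoc]

omit [∀ i, DecidableEq (n i)] in
lemma exists_wsum_functional (w : Fin k → ℝ) :
    ∃ h : Alg (TensorShape n (Full k)) →ₗ[ℂ] ℂ, ∀ P, (h P).re = wsum w P := by
  refine ⟨Matrix.traceLinearMap (Fin k) ℂ ℂ ∘ₗ LinearMap.mulLeft ℂ (realDiag w) ∘ₗ marg,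
    fun P => ?_⟩
  exact re_trace_realDiag_mul w (marg P)

/-- If a positive functional is bounded by two diagonal weights, then it is bounded by their
weighted harmonic mean. -/
lemma re_le_wsum_harmonic (x : Alg (TensorShape n (Full k)) →ₗ[ℂ] ℂ)
    (hx : ∀ P, IsPos P → 0 ≤ (x P).re) {N : Fin k → ℝ} (hN : ∀ i, 0 ≤ N i)
    (hxN : ∀ P, IsPos P → (x P).re ≤ wsum N P) (hx1 : ∀ P, IsPos P → (x P).re ≤ (tr P).re)
    {s c : ℝ} (hs : 0 < s) (hc : 0 < c) (hsc : s + c = 1)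
    (P : Alg (TensorShape n (Full k))) (hP : IsPos P) :
    (x P).re ≤ wsum (fun i => N i / (s + c * N i)) P := by
  have hd : ∀ i, 0 < s + c * N i := fun i => by have := hN i; positivity
  -- For each index these minimise `a² N / s + b² / c` subject to `a + b = 1`; the minimum is `N /
  -- (s + cN)`.
  set a : Fin k → ℝ := fun i => s / (s + c * N i) with ha
  set b : Fin k → ℝ := fun i => c * N i / (s + c * N i) with hb
  have hab : realDiag a + realDiag b = 1 := by
    rw [realDiag, realDiag, Matrix.diagonal_add, ← Matrix.diagonal_one]
    congr 1
    ext i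
    rw [← Complex.ofReal_add, ← add_div, div_self (hd i).ne', Complex.ofReal_one]
  set A := realDiag a
  set B := realDiag b
  have hA : Aᴴ = A := realDiag_conjTranspose a
  have hB : Bᴴ = B := realDiag_conjTranspose b
  -- Positivity on this congruence controls the cross terms of `(A + B) P (A + B)`. As `s + c = 1`,
  -- it amounts to `cs x(P) ≤ c x(APA) + s x(BPB)`.
  have h1 := hx _ (hP.ampConj ((c : ℂ) • A - (s : ℂ) • B))
  have e1 : ((c : ℂ) • A - (s : ℂ) • B)ᴴ = (c : ℂ) • A - (s : ℂ) • B := by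
    simp [Matrix.conjTranspose_sub, Matrix.conjTranspose_smul, hA, hB]
  have e2 : P = ampConj (A + B) (A + B) P := by rw [hab, ampConj_one]
  have e3 : ampConj (A + B) (A + B) P = ampConj A A P + ampConj B B P +
      (amp A * P * amp B + amp B * P * amp A) := by
    simp only [ampConj_apply, amp_add]; noncomm_ring
  have e4 : ampConj ((c : ℂ) • A - (s : ℂ) • B) ((c : ℂ) • A - (s : ℂ) • B) P =
      ((c ^ 2 : ℝ) : ℂ) • ampConj A A P + ((s ^ 2 : ℝ) : ℂ) • ampConj B B P -
      ((c * s : ℝ) : ℂ) • (amp A * P * amp B + amp B * P * amp A) := by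
    simp only [ampConj_apply, amp_sub, amp_smul, mul_sub, sub_mul, smul_mul_assoc, mul_smul_comm]
    push_cast
    module
  rw [e1, e4, map_sub, map_add, map_smul, map_smul, map_smul] at h1
  simp only [smul_eq_mul, Complex.sub_re, Complex.add_re, Complex.re_ofReal_mul] at h1
  have h2 : (x P).re = (x (ampConj A A P)).re + (x (ampConj B B P)).re +
      (x (amp A * P * amp B + amp B * P * amp A)).re := by
    conv_lhs => rw [e2, e3]
    simp only [map_add, Complex.add_re]
  have hPA : IsPos (ampConj A A P) := by simpa only [hA] using hP.ampConj A
  have hPB : IsPos (ampConj B B P) := by simpa only [hB] using hP.ampConj B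
  have h3 := hxN _ hPA
  have h4 := hx1 _ hPB
  rw [wsum_ampConj] at h3
  rw [re_tr_eq_wsum, wsum_ampConj] at h4
  have h5 : wsum (fun i => N i / (s + c * N i)) P =
      1 / s * wsum (fun i => N i * a i ^ 2) P + 1 / c * wsum (fun i => 1 * b i ^ 2) P := by
    rw [mul_wsum, mul_wsum, wsum_add]
    congr 1
    ext i
    have := (hd i).ne'
    simp only [ha, hb]
    field_simp
  rw [h5]
  have h6 : c * s * (x P).re ≤ c * (x (ampConj A A P)).re + s * (x (ampConj B B P)).re := by
    have : c * s * (x P).re = c * s * (x (ampConj A A P)).re + c * s * (x (ampConj B B P)).re +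
      c * s * (x (amp A * P * amp B + amp B * P * amp A)).re := by rw [h2]; ring
    have e5 : s = 1 - c := by linarith
    have p1 : c * (x (ampConj A A P)).re =
        c ^ 2 * (x (ampConj A A P)).re + c * s * (x (ampConj A A P)).re := by rw [e5]; ring
    have p2 : s * (x (ampConj B B P)).re =
        s ^ 2 * (x (ampConj B B P)).re + c * s * (x (ampConj B B P)).re := by rw [e5]; ring
    linarith
  have h7 : (x P).re ≤ 1 / s * (x (ampConj A A P)).re + 1 / c * (x (ampConj B B P)).re := by
    have : 1 / s * (x (ampConj A A P)).re + 1 / c * (x (ampConj B B P)).re =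
        (c * (x (ampConj A A P)).re + s * (x (ampConj B B P)).re) / (c * s) := by
      field_simp
    rw [this, le_div_iff₀ (by positivity)]
    linarith
  refine h7.trans ?_
  gcongr

end Functionals

/-! ### From domination of effects to operator bounds. -/

section Comparison

variable {ι ι' κ : Type*} [Fintype ι] [DecidableEq ι] [Fintype ι'] [DecidableEq ι'] [Fintype κ]
  [DecidableEq κ]
  {a : ι → Type*} [∀ i, Fintype (a i)] [∀ i, DecidableEq (a i)]
  {a' : ι' → Type*} [∀ i, Fintype (a' i)] [∀ i, DecidableEq (a' i)]
  {b : κ → Type*} [∀ j, Fintype (b j)] [∀ j, DecidableEq (b j)]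
  {Φ : Alg a →ₗ[ℂ] Alg b} {Ψ : Alg a' →ₗ[ℂ] Alg b} {k : ℕ} {ε : ℝ}

omit [DecidableEq κ] [∀ j, DecidableEq (b j)] in
lemma IsChannel.isPos_stab {φ : Alg a →ₗ[ℂ] Alg b} (h : IsChannel φ)
    {P : Alg (TensorShape a (Full k))} (hP : IsPos P) : IsPos (stab k φ P) := h.1 k P hP

omit [DecidableEq κ] [∀ j, DecidableEq (b j)] in
lemma IsChannel.wsum_stab {φ : Alg a →ₗ[ℂ] Alg b} (h : IsChannel φ) (w : Fin k → ℝ)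
    (P : Alg (TensorShape a (Full k))) : wsum w (stab k φ P) = wsum w P := by
  rw [wsum, wsum, marg_stab h.2]

/-- The values of effects on the range of `Φ ⊗ id` exceed those on the range of `Ψ ⊗ id` by at
most `ε`. -/
def EffectDominated (k : ℕ) (ε : ℝ) (Ψ : Alg a' →ₗ[ℂ] Alg b) (Φ : Alg a →ₗ[ℂ] Alg b) : Prop :=
  ∀ g : Alg (TensorShape b (Full k)) →ₗ[ℂ] ℂ, IsEffect g →
    ∀ σ : Alg (TensorShape a (Full k)), IsState σ →
      ∃ ρ : Alg (TensorShape a' (Full k)), IsState ρ ∧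
        (g (stab k Φ σ)).re ≤ (g (stab k Ψ ρ)).re + ε

omit [DecidableEq κ] in
-- Rescale `g` by `r^(-1/2)` on the ancilla and add the weight `β - z/r`. The conditions on `r` are
-- what makes this an effect, and on the range of `Ψ ⊗ id` the shift cancels `z/r`, leaving the
-- constant bound `β`. Domination then gives `β + ε` on the range of `Φ ⊗ id`; undoing the rescaling
-- turns `ε` into `ε r`.
lemma EffectDominated.re_le_wsum (H : EffectDominated k ε Ψ Φ) (hΦ : IsChannel Φ)
    (hΨ : IsChannel Ψ) {g : Alg (TensorShape b (Full k)) →ₗ[ℂ] ℂ} (hg : IsEffect g)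
    {z r : Fin k → ℝ} {α β : ℝ} (hαβ : α + β = 1) (hr : ∀ i, 0 < r i)
    (hrα : ∀ i, 1 - z i ≤ α * r i) (hrβ : ∀ i, z i ≤ β * r i)
    (hz : ∀ P, IsPos P → (g (stab k Ψ P)).re ≤ wsum z P)
    (P : Alg (TensorShape a (Full k))) (hP : IsPos P) :
    (g (stab k Φ P)).re ≤ wsum (fun i => z i + ε * r i) P := by
  set l : Fin k → ℝ := fun i => (Real.sqrt (r i))⁻¹ with hl
  have hl2 : ∀ i, l i ^ 2 = (r i)⁻¹ := fun i => by
    rw [hl]; simp only [inv_pow, Real.sq_sqrt (hr i).le]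
  obtain ⟨h, hh⟩ := exists_wsum_functional (n := b) fun i => β - z i / r i
  let g₁ : Alg (TensorShape b (Full k)) →ₗ[ℂ] ℂ := g ∘ₗ ampConj (realDiag l) (realDiag l) + h
  have hg₁ : ∀ Q, (g₁ Q).re = (g (ampConj (realDiag l) (realDiag l) Q)).re +
      wsum (fun i => β - z i / r i) Q := fun Q => by
    rw [← hh]; rfl
  have heff : IsEffect g₁ := by
    intro Q hQ
    obtain ⟨h0, h1⟩ := hg _ (hQ.ampConj_realDiag l)
    rw [re_tr_eq_wsum, wsum_ampConj] at h1
    rw [hg₁, re_tr_eq_wsum]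
    constructor
    · refine add_nonneg h0 ?_
      have := hQ.wsum_mono (v := fun _ => 0) (w := fun i => β - z i / r i) fun i =>
        sub_nonneg.2 ((div_le_iff₀ (hr i)).2 (hrβ i))
      simpa [wsum] using this
    · refine (add_le_add_left h1 _).trans ?_
      rw [wsum_add]
      refine hQ.wsum_mono fun i => ?_
      have : (1 - z i) / r i ≤ α := (div_le_iff₀ (hr i)).2 (hrα i)
      rw [hl2, one_mul]
      have e : (r i)⁻¹ + (β - z i / r i) = (1 - z i) / r i + β := by
        rw [sub_div, one_div]; ring
      rw [e]; linarith
  set d : Fin k → ℝ := fun i => Real.sqrt (r i) with hd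
  have hd2 : ∀ i, d i ^ 2 = r i := fun i => Real.sq_sqrt (hr i).le
  have hld : realDiag l * realDiag d = 1 := by
    rw [realDiag_mul, ← realDiag_one]
    congr 1
    ext i
    exact inv_mul_cancel₀ (Real.sqrt_pos.2 (hr i)).ne'
  have hdl : realDiag d * realDiag l = 1 := by
    rw [realDiag_mul, ← realDiag_one]
    congr 1
    ext i
    exact mul_inv_cancel₀ (Real.sqrt_pos.2 (hr i)).ne'
  set P' := ampConj (realDiag d) (realDiag d) P with hP'
  have hP'pos : IsPos P' := by
    exact hP.ampConj_realDiag d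
  have hP'P : ampConj (realDiag l) (realDiag l) P' = P := by
    rw [hP', ampConj_ampConj, hld, hdl, ampConj_one]
  have hτ : (tr P').re = wsum r P := by
    rw [re_tr_eq_wsum, hP', wsum_ampConj]; simp [hd2]
  have hτ0 : 0 ≤ (tr P').re := (Complex.le_def.1 hP'pos.tr_nonneg).1
  have him : tr P' = ((tr P').re : ℂ) := (Complex.ext rfl (by
    simpa using (Complex.le_def.1 hP'pos.tr_nonneg).2.symm))
  -- If `P'` has trace zero it cannot be normalised to a state, but then the marginal of `P` has
  -- zero diagonal and both sides are trivial.
  rcases hτ0.eq_or_lt with hτ0 | hτ0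
  · have hm : ∀ i, (marg P i i).re = 0 := by
      have h0 : ∀ i ∈ Finset.univ, 0 ≤ r i * (marg P i i).re := fun i _ =>
        mul_nonneg (hr i).le (Complex.le_def.1 hP.marg.diag_nonneg).1
      rw [hτ] at hτ0
      intro i
      have := (Finset.sum_eq_zero_iff_of_nonneg h0).1 hτ0.symm i (Finset.mem_univ i)
      exact (mul_eq_zero.1 this).resolve_left (hr i).ne'
    have h1 := (hg _ (hΦ.isPos_stab hP)).2
    rw [tr_stab hΦ.2, re_tr_eq_wsum] at h1
    refine h1.trans (le_of_eq ?_)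
    simp [wsum, hm]
  · set τ := (tr P').re
    have hσ : IsState (((τ⁻¹ : ℝ) : ℂ) • P') := by
      refine ⟨hP'pos.smul (inv_nonneg.2 hτ0.le), ?_⟩
      rw [tr_smul, him, ← Complex.ofReal_mul, inv_mul_cancel₀ hτ0.ne', Complex.ofReal_one]
    obtain ⟨ρ, hρ, hle⟩ := H g₁ heff _ hσ
    have h1 : (g₁ (stab k Ψ ρ)).re ≤ β := by
      rw [hg₁, ← stab_ampConj, hΨ.wsum_stab]
      have := hz _ (hρ.1.ampConj_realDiag l)
      rw [wsum_ampConj] at this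
      refine (add_le_add_left this _).trans (le_of_eq ?_)
      rw [wsum_add]
      have e : (fun i => z i * l i ^ 2 + (β - z i / r i)) = fun i : Fin k => β * 1 := by
        ext i; rw [hl2, div_eq_mul_inv]; ring
      rw [e, ← mul_wsum, ← re_tr_eq_wsum, hρ.2]
      simp
    have h2 : (g₁ (stab k Φ (((τ⁻¹ : ℝ) : ℂ) • P'))).re =
        τ⁻¹ * ((g (stab k Φ P)).re + wsum (fun i => β * r i - z i) P) := by
      rw [map_smul, map_smul, smul_eq_mul, Complex.re_ofReal_mul, hg₁, ← stab_ampConj, hP'P,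
        hΦ.wsum_stab, hP', wsum_ampConj]
      congr 4
      ext i
      have := (hr i).ne'
      rw [hd2]; field_simp
    have h3 := hle.trans (add_le_add_left h1 ε)
    rw [h2, inv_mul_le_iff₀ hτ0, hτ] at h3
    have h4 : wsum (fun i => z i + ε * r i) P + wsum (fun i => β * r i - z i) P =
        wsum r P * (β + ε) := by
      rw [wsum_add, mul_comm, mul_wsum]
      congr 1
      ext i
      ring
    linarith

omit [DecidableEq κ] in
lemma EffectDominated.re_le_wsum_add (H : EffectDominated k ε Ψ Φ) (hε : 0 ≤ ε)
    (hΦ : IsChannel Φ)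
    (hΨ : IsChannel Ψ) {g : Alg (TensorShape b (Full k)) →ₗ[ℂ] ℂ} (hg : IsEffect g)
    {z : Fin k → ℝ} (hz0 : ∀ i, 0 ≤ z i)
    (hz : ∀ P, IsPos P → (g (stab k Ψ P)).re ≤ wsum z P)
    (P : Alg (TensorShape a (Full k))) (hP : IsPos P) :
    (g (stab k Φ P)).re ≤ wsum (fun i => z i + (ε + 1 / 2 * Real.sqrt ε)) P := by
  have hx1 : ∀ P, IsPos P → (g (stab k Φ P)).re ≤ (tr P).re := fun P hP => by
    rw [← tr_stab hΦ.2 P]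
    exact (hg _ (hΦ.isPos_stab hP)).2
  rcases le_or_gt 1 (ε + 1 / 2 * Real.sqrt ε) with h1 | h1
  · refine (hx1 P hP).trans ?_
    rw [re_tr_eq_wsum]
    exact hP.wsum_mono fun i => by linarith [hz0 i]
  rcases hε.eq_or_lt with rfl | hε
  -- For `ε = 0` the term `ε r` vanishes, so any admissible `r` will do.
  · have := H.re_le_wsum hΦ hΨ hg (z := z) (r := fun i => 2 * (1 + z i)) (α := 1 / 2) (β := 1 / 2)
      (by norm_num) (fun i => by linarith [hz0 i]) (fun i => by linarith [hz0 i])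
      (fun i => by linarith [hz0 i]) hz P hP
    simpa using this
  · obtain ⟨α, β, s, c, hα, hβ, hs, hc, hαβ, hsc, hw⟩ := exists_weights hε h1
    set r : Fin k → ℝ := fun i => max ((1 - z i) / α) (z i / β) with hr
    have hr0 : ∀ i, 0 < r i := fun i => by
      rcases (hz0 i).eq_or_lt with h | h
      · exact lt_max_of_lt_left (by rw [← h]; simpa using hα)
      · exact lt_max_of_lt_right (div_pos h hβ)
    have hN0 : ∀ i, 0 ≤ z i + ε * r i := fun i => by
      have := hz0 i; have := hr0 i; positivity
    have hN := H.re_le_wsum hΦ hΨ hg (z := z) (r := r) hαβ hr0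
      (fun i => by rw [← div_le_iff₀' hα]; exact le_max_left _ _)
      (fun i => by rw [← div_le_iff₀' hβ]; exact le_max_right _ _) hz
    refine (re_le_wsum_harmonic (g ∘ₗ stab k Φ) (fun P hP => (hg _ (hΦ.isPos_stab hP)).1) hN0
      hN hx1 hs hc hsc P hP).trans (hP.wsum_mono fun i => ?_)
    have := hN0 i
    rw [div_le_iff₀ (by positivity)]
    exact hw (z i) (hz0 i)

lemma exists_simultaneous_congruence {m : Type*} [Fintype m] [DecidableEq m] {S T : Matrix m m ℂ}
    (hS : S.PosDef) (hT : T.PosSemidef) :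
    ∃ (W V : Matrix m m ℂ) (z : m → ℝ), W * V = 1 ∧ V * W = 1 ∧ (∀ i, 0 ≤ z i) ∧ S = Wᴴ * W ∧
      T = Wᴴ * diagonal (fun i => (z i : ℂ)) * W := by
  obtain ⟨B, hB⟩ := exists_conjTranspose_mul_self hS.posSemidef
  have hBu : IsUnit B.det := by
    have := (Matrix.isUnit_iff_isUnit_det S).1 hS.isUnit
    rw [hB, Matrix.det_mul] at this
    exact isUnit_of_mul_isUnit_right this
  have hM := hT.conjTranspose_mul_mul_same B⁻¹
  obtain ⟨U, hU, hU', h⟩ := exists_unitary_diagonalization hM.1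
  refine ⟨Uᴴ * B, B⁻¹ * U, hM.1.eigenvalues, ?_, ?_, hM.eigenvalues_nonneg, ?_, ?_⟩
  · rw [Matrix.mul_assoc, ← Matrix.mul_assoc B, Matrix.mul_nonsing_inv _ hBu, one_mul, hU']
  · rw [Matrix.mul_assoc, ← Matrix.mul_assoc U, hU, one_mul, Matrix.nonsing_inv_mul _ hBu]
  · rw [Matrix.conjTranspose_mul, Matrix.conjTranspose_conjTranspose, Matrix.mul_assoc,
      ← Matrix.mul_assoc U, hU, one_mul, hB]
  · rw [Matrix.conjTranspose_mul, Matrix.conjTranspose_conjTranspose]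
    have e : Bᴴ * U * diagonal (fun i => (hM.1.eigenvalues i : ℂ)) * (Uᴴ * B) =
        Bᴴ * (U * diagonal (fun i => (hM.1.eigenvalues i : ℂ)) * Uᴴ) * B := by
      simp only [Matrix.mul_assoc]
    rw [e, ← h]
    have h1 : Bᴴ * (B⁻¹)ᴴ = 1 := by
      rw [← Matrix.conjTranspose_mul, Matrix.nonsing_inv_mul _ hBu, Matrix.conjTranspose_one]
    rw [← Matrix.mul_assoc, ← Matrix.mul_assoc, h1, one_mul, Matrix.mul_assoc,
      Matrix.nonsing_inv_mul _ hBu, mul_one]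

omit [DecidableEq κ] in
-- In coordinates where `S` is the identity and `T` is diagonal, `g` becomes an effect. The
-- congruence acts on the ancilla alone, so it commutes with `Φ ⊗ id` and `Ψ ⊗ id`.
lemma EffectDominated.re_le_trace (H : EffectDominated k ε Ψ Φ) (hε : 0 ≤ ε)
    (hΦ : IsChannel Φ) (hΨ : IsChannel Ψ) {g : Alg (TensorShape b (Full k)) →ₗ[ℂ] ℂ}
    (hg : ∀ P, IsPos P → 0 ≤ (g P).re) {S T : Matrix (Fin k) (Fin k) ℂ} (hS : S.PosDef)
    (hT : T.PosSemidef) (hgS : ∀ P, IsPos P → (g P).re ≤ (S * marg P).trace.re)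
    (hgT : ∀ P, IsPos P → (g (stab k Ψ P)).re ≤ (T * marg P).trace.re)
    (P : Alg (TensorShape a (Full k))) (hP : IsPos P) :
    (g (stab k Φ P)).re ≤
      (T * marg P).trace.re + (ε + 1 / 2 * Real.sqrt ε) * (S * marg P).trace.re := by
  obtain ⟨W, V, z, hWV, hVW, hz0, hSW, hTW⟩ := exists_simultaneous_congruence hS hT
  have hWV' : Vᴴ * Wᴴ = 1 := by rw [← Matrix.conjTranspose_mul, hWV, Matrix.conjTranspose_one]
  have hVW' : Wᴴ * Vᴴ = 1 := by rw [← Matrix.conjTranspose_mul, hVW, Matrix.conjTranspose_one]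
  have tS : ∀ M : Matrix (Fin k) (Fin k) ℂ, (S * M).trace = (W * M * Wᴴ).trace := fun M => by
    rw [hSW, Matrix.mul_assoc, Matrix.trace_mul_comm]
  have tT : ∀ M : Matrix (Fin k) (Fin k) ℂ, (T * M).trace = (realDiag z * (W * M * Wᴴ)).trace :=
    fun M => by
      rw [hTW, Matrix.mul_assoc, Matrix.mul_assoc, Matrix.trace_mul_comm]
      simp only [realDiag, Matrix.mul_assoc]
  have cancel : ∀ M : Matrix (Fin k) (Fin k) ℂ, W * (V * M * Vᴴ) * Wᴴ = M := fun M => by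
    rw [← Matrix.mul_assoc, ← Matrix.mul_assoc, hWV, one_mul, Matrix.mul_assoc, hWV', mul_one]
  have heff : IsEffect (g ∘ₗ ampConj V Vᴴ) := by
    intro Q hQ
    refine ⟨hg _ (hQ.ampConj V), (hgS _ (hQ.ampConj V)).trans (le_of_eq ?_)⟩
    rw [marg_ampConj, tS, cancel, trace_marg]
  have hz : ∀ Q, IsPos Q → ((g ∘ₗ ampConj V Vᴴ) (stab k Ψ Q)).re ≤ wsum z Q := by
    intro Q hQ
    rw [LinearMap.comp_apply, ← stab_ampConj]
    refine (hgT _ (hQ.ampConj V)).trans (le_of_eq ?_)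
    rw [marg_ampConj, tT, cancel, re_trace_realDiag_mul, wsum]
  have := H.re_le_wsum_add hε hΦ hΨ heff hz0 hz _ (hP.ampConj W)
  rw [LinearMap.comp_apply, ← stab_ampConj, ampConj_ampConj, hVW, hVW', ampConj_one] at this
  refine this.trans (le_of_eq ?_)
  rw [tT, tS, re_trace_realDiag_mul, ← marg_ampConj, trace_marg, re_tr_eq_wsum, mul_wsum]
  rw [← wsum_add]
  simp only [mul_one]
  rfl

end Comparison


/-! ### The trace norm as a supremum over effects. -/

section TraceNorm

variable {m : Type*} [Fintype m] [DecidableEq m]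

/-- The two enumerations of eigenvalues need not match, so the multisets of roots of the
characteristic polynomial are compared. -/
lemma sum_sqrt_eigenvalues_conjTranspose_mul_self {A : Matrix m m ℂ} (hA : A.IsHermitian) :
    ∑ i, Real.sqrt ((Matrix.isHermitian_conjTranspose_mul_self A).eigenvalues i) =
      ∑ i, |hA.eigenvalues i| := by
  obtain ⟨U, hU, hU', h⟩ := exists_unitary_diagonalization hA
  set hB := Matrix.isHermitian_conjTranspose_mul_self A
  have e : Aᴴ * A = U * diagonal (fun i => ((hA.eigenvalues i ^ 2 : ℝ) : ℂ)) * Uᴴ := by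
    rw [hA.eq]
    conv_lhs => rw [h]
    have : diagonal (fun i => ((hA.eigenvalues i ^ 2 : ℝ) : ℂ)) =
        diagonal (fun i => (hA.eigenvalues i : ℂ)) * diagonal (fun i => (hA.eigenvalues i : ℂ)) := by
      simp [Matrix.diagonal_mul_diagonal, sq]
    rw [this]
    simp only [Matrix.mul_assoc]
    rw [← Matrix.mul_assoc Uᴴ U, hU', one_mul]
  have h1 : (Aᴴ * A).charpoly.roots =
      Multiset.map (fun i => ((hA.eigenvalues i ^ 2 : ℝ) : ℂ)) Finset.univ.val := by
    rw [e, Matrix.charpoly_mul_comm, ← Matrix.mul_assoc, hU', one_mul, Matrix.charpoly_diagonal]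
    rw [Polynomial.roots_prod _ _ (by
      rw [Finset.prod_ne_zero_iff]; exact fun i _ => Polynomial.X_sub_C_ne_zero _)]
    simp only [Polynomial.roots_X_sub_C, Multiset.bind_singleton]
  have h2 := hB.roots_charpoly_eq_eigenvalues
  rw [h1] at h2
  have h3 := congrArg (fun s => (Multiset.map (fun w : ℂ => Real.sqrt w.re) s).sum) h2
  simp only [Multiset.map_map, Function.comp_def] at h3
  have h4 : ∀ f : m → ℝ, ∑ i, f i = (Multiset.map f Finset.univ.val).sum := fun f => rfl
  rw [h4, h4]
  simp only [Complex.ofReal_re, Real.sqrt_sq_eq_abs] at h3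
  exact h3.symm

lemma two_mul_re_trace_mul_le {A G : Matrix m m ℂ} (hA : A.IsHermitian) (hG : G.PosSemidef)
    (hG1 : (1 - G).PosSemidef) :
    2 * (G * A).trace.re ≤ A.trace.re + ∑ i, |hA.eigenvalues i| := by
  obtain ⟨U, hU, hU', h⟩ := exists_unitary_diagonalization hA
  have e : (G * A).trace.re = ∑ i, ((Uᴴ * G * U) i i).re * hA.eigenvalues i := by
    conv_lhs => rw [h]
    rw [← Matrix.mul_assoc, Matrix.trace_mul_comm, ← Matrix.mul_assoc, ← Matrix.mul_assoc]
    simp [Matrix.trace, Matrix.mul_diagonal]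
  have et : A.trace.re = ∑ i, hA.eigenvalues i := by
    rw [hA.trace_eq_sum_eigenvalues]; simp
  rw [e, et, Finset.mul_sum, ← Finset.sum_add_distrib]
  refine Finset.sum_le_sum fun i _ => ?_
  have h0 := (Complex.le_def.1 ((hG.conjTranspose_mul_mul_same U).diag_nonneg (i := i))).1
  have h1 := (Complex.le_def.1 ((hG1.conjTranspose_mul_mul_same U).diag_nonneg (i := i))).1
  rw [mul_sub, sub_mul, mul_one, hU'] at h1
  rw [Matrix.sub_apply, Matrix.one_apply_eq, Complex.sub_re, Complex.one_re] at h1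
  rw [Complex.zero_re] at h0 h1
  rcases abs_cases (hA.eigenvalues i) with ⟨h, _⟩ | ⟨h, _⟩ <;> rw [h] <;> nlinarith

/-- The spectral projection onto the nonnegative part attains the bound of
`two_mul_re_trace_mul_le`. -/
lemma exists_two_mul_re_trace_mul_eq {A : Matrix m m ℂ} (hA : A.IsHermitian) :
    ∃ G : Matrix m m ℂ, G.PosSemidef ∧ (1 - G).PosSemidef ∧
      2 * (G * A).trace.re = A.trace.re + ∑ i, |hA.eigenvalues i| := by
  obtain ⟨U, hU, hU', h⟩ := exists_unitary_diagonalization hA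
  let D : Matrix m m ℂ := diagonal fun i => if 0 ≤ hA.eigenvalues i then 1 else 0
  refine ⟨U * D * Uᴴ, ?_, ?_, ?_⟩
  · refine Matrix.PosSemidef.mul_mul_conjTranspose_same (Matrix.PosSemidef.diagonal fun i => ?_) U
    simp only [Pi.zero_apply]
    split_ifs <;> simp
  · have : 1 - U * D * Uᴴ = U * (diagonal fun i => if 0 ≤ hA.eigenvalues i then 0 else 1) * Uᴴ := by
      have e : (diagonal fun i => if 0 ≤ hA.eigenvalues i then (0 : ℂ) else 1) = 1 - D := by
        rw [← Matrix.diagonal_one, Matrix.diagonal_sub]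
        congr 1
        ext i
        split_ifs <;> simp
      rw [e, mul_sub, sub_mul, mul_one, hU]
    rw [this]
    refine Matrix.PosSemidef.mul_mul_conjTranspose_same (Matrix.PosSemidef.diagonal fun i => ?_) U
    simp only [Pi.zero_apply]
    split_ifs <;> simp
  · have e : (U * D * Uᴴ * A).trace.re =
        ∑ i, if 0 ≤ hA.eigenvalues i then hA.eigenvalues i else 0 := by
      conv_lhs => rw [h]
      have : U * D * Uᴴ * (U * diagonal (fun i => (hA.eigenvalues i : ℂ)) * Uᴴ) =
          U * (D * diagonal (fun i => (hA.eigenvalues i : ℂ))) * Uᴴ := by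
        simp only [Matrix.mul_assoc]
        rw [← Matrix.mul_assoc Uᴴ U, hU', one_mul]
      rw [this, Matrix.trace_mul_comm, ← Matrix.mul_assoc, hU', one_mul,
        Matrix.diagonal_mul_diagonal, Matrix.trace_diagonal, Complex.re_sum]
      refine Finset.sum_congr rfl fun i _ => ?_
      split_ifs <;> simp
    have et : A.trace.re = ∑ i, hA.eigenvalues i := by
      rw [hA.trace_eq_sum_eigenvalues]; simp
    rw [e, et, Finset.mul_sum, ← Finset.sum_add_distrib]
    refine Finset.sum_congr rfl fun i _ => ?_
    split_ifs with hi
    · rw [abs_of_nonneg hi]; ring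
    · rw [abs_of_neg (not_le.1 hi)]; ring

omit [DecidableEq m] in
lemma posSemidef_of_re_trace_nonneg {G : Matrix m m ℂ} (hG : G.IsHermitian)
    (h : ∀ K : Matrix m m ℂ, K.PosSemidef → 0 ≤ (G * K).trace.re) : G.PosSemidef := by
  refine Matrix.PosSemidef.of_dotProduct_mulVec_nonneg hG fun v => ?_
  have := h _ (Matrix.posSemidef_vecMulVec_self_star v)
  rw [Matrix.mul_vecMulVec, Matrix.trace_vecMulVec, dotProduct_comm] at this
  exact Complex.le_def.2 ⟨this, (hG.im_star_dotProduct_mulVec_self v).symm⟩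

end TraceNorm

section Blocks

variable {ι : Type*} [Fintype ι] {n : ι → Type*} [∀ i, Fintype (n i)] [∀ i, DecidableEq (n i)]

omit [Fintype ι] [(i : ι) → Fintype (n i)] [(i : ι) → DecidableEq (n i)] in
lemma isHermitian_block {x : Alg n} (hx : star x = x) (i : ι) : (x i).IsHermitian :=
  congrFun hx i

omit [(i : ι) → DecidableEq (n i)] in
lemma re_tr_eq_sum (x : Alg n) : (tr x).re = ∑ i, (x i).trace.re := Complex.re_sum _ _

lemma two_mul_re_tr_mul_le_traceNorm {x G : Alg n} (hx : star x = x) (hG : IsPos G)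
    (hG1 : IsPos (1 - G)) : 2 * (tr (G * x)).re ≤ (tr x).re + traceNorm x := by
  rw [re_tr_eq_sum, re_tr_eq_sum, traceNorm, Finset.mul_sum, ← Finset.sum_add_distrib]
  refine Finset.sum_le_sum fun i _ => ?_
  rw [sum_sqrt_eigenvalues_conjTranspose_mul_self (isHermitian_block hx i)]
  exact two_mul_re_trace_mul_le (isHermitian_block hx i) (hG i) (hG1 i)

lemma exists_two_mul_re_tr_mul_eq_traceNorm {x : Alg n} (hx : star x = x) :
    ∃ G : Alg n, IsPos G ∧ IsPos (1 - G) ∧ 2 * (tr (G * x)).re = (tr x).re + traceNorm x := by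
  choose G h0 h1 h2 using fun i => exists_two_mul_re_trace_mul_eq (isHermitian_block hx i)
  refine ⟨G, h0, h1, ?_⟩
  rw [re_tr_eq_sum, re_tr_eq_sum, traceNorm, Finset.mul_sum, ← Finset.sum_add_distrib]
  refine Finset.sum_congr rfl fun i _ => ?_
  rw [sum_sqrt_eigenvalues_conjTranspose_mul_self (isHermitian_block hx i)]
  exact h2 i

variable [DecidableEq ι]

omit [Fintype ι] [∀ i, Fintype (n i)] [∀ i, DecidableEq (n i)] in
lemma isPos_single {i : ι} {K : Matrix (n i) (n i) ℂ} (hK : K.PosSemidef) :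
    IsPos (Pi.single i K : Alg n) := by
  intro j
  rcases eq_or_ne i j with rfl | h
  · rwa [Pi.single_eq_same]
  · rw [Pi.single_eq_of_ne h.symm]
    exact Matrix.PosSemidef.zero

omit [∀ i, DecidableEq (n i)] in
lemma tr_mul_single (G : Alg n) (i : ι) (K : Matrix (n i) (n i) ℂ) :
    tr (G * (Pi.single i K : Alg n)) = (G i * K).trace := by
  rw [tr, Finset.sum_eq_single i]
  · simp
  · intro j _ hj
    simp [Pi.single_eq_of_ne hj]
  · simp

lemma exists_re_tr_mul_eq (g : Alg n →ₗ[ℂ] ℂ) :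
    ∃ G : Alg n, star G = G ∧ ∀ x, star x = x → (g x).re = (tr (G * x)).re := by
  choose G hG h using fun i =>
    exists_isHermitian_re_trace_eq (g ∘ₗ LinearMap.single ℂ (fun i => Matrix (n i) (n i) ℂ) i)
  refine ⟨G, funext hG, fun x hx => ?_⟩
  conv_lhs => rw [← Finset.univ_sum_single x]
  rw [map_sum, Complex.re_sum, re_tr_eq_sum]
  exact Finset.sum_congr rfl fun i _ => h i (x i) (isHermitian_block hx i)

lemma IsEffect.exists_re_tr_mul_eq {g : Alg n →ₗ[ℂ] ℂ} (hg : IsEffect g) :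
    ∃ G : Alg n, IsPos G ∧ IsPos (1 - G) ∧ ∀ x, star x = x → (g x).re = (tr (G * x)).re := by
  obtain ⟨G, hG, h⟩ := ChannelComparison.exists_re_tr_mul_eq g
  have hs : ∀ i (K : Matrix (n i) (n i) ℂ), K.PosSemidef →
      0 ≤ (G i * K).trace.re ∧ (G i * K).trace.re ≤ K.trace.re := fun i K hK => by
    have hp := isPos_single (n := n) hK
    have := hg _ hp
    rw [h _ hp.star_eq, tr_mul_single] at this
    refine ⟨this.1, this.2.trans (le_of_eq ?_)⟩
    have := tr_mul_single (1 : Alg n) i K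
    rw [one_mul] at this
    rw [this, Pi.one_apply, one_mul]
  refine ⟨G, fun i => posSemidef_of_re_trace_nonneg (isHermitian_block hG i) fun K hK =>
    (hs i K hK).1, fun i => posSemidef_of_re_trace_nonneg
      (Matrix.isHermitian_one.sub (isHermitian_block hG i)) fun K hK => ?_, h⟩
  have := (hs i K hK).2
  rw [Pi.sub_apply, Pi.one_apply, sub_mul, one_mul, Matrix.trace_sub, Complex.sub_re]
  linarith

omit [DecidableEq ι] in
lemma isEffect_of_isPos {G : Alg n} (hG : IsPos G) (hG1 : IsPos (1 - G)) {f : Alg n →ₗ[ℂ] ℂ}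
    (hf : ∀ x, f x = tr (G * x)) : IsEffect f := by
  intro P hP
  rw [hf]
  refine ⟨(Complex.le_def.1 (hG.tr_mul_nonneg hP)).1, ?_⟩
  have := (Complex.le_def.1 (hG1.tr_mul_nonneg hP)).1
  rw [sub_mul, one_mul, tr_sub] at this
  simpa using this

end Blocks


/-! ### Compact convex sets of states and effects; existence of channels. -/

section States

variable {ι : Type*} [Fintype ι] {n : ι → Type*} [∀ i, Fintype (n i)]

lemma IsPos.tr_eq_re {x : Alg n} (hx : IsPos x) : tr x = ((tr x).re : ℂ) :=
  Complex.ext rfl (by simpa using (Complex.le_def.1 hx.tr_nonneg).2.symm)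

lemma IsPos.isState_smul {x : Alg n} (hx : IsPos x) {τ : ℝ} (hτ : 0 < τ) (h : (tr x).re = τ) :
    IsState (((τ⁻¹ : ℝ) : ℂ) • x) := by
  refine ⟨hx.smul (inv_nonneg.2 hτ.le), ?_⟩
  rw [tr_smul, hx.tr_eq_re, h, ← Complex.ofReal_mul, inv_mul_cancel₀ hτ.ne', Complex.ofReal_one]

lemma isCompact_isState : IsCompact {x : Alg n | IsState x} := by
  refine (isCompact_isPos_tr_le (n := n) 1).of_isClosed_subset ?_ ?_
  · exact isClosed_isPos.inter (isClosed_eq continuous_tr continuous_const)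
  · rintro x ⟨hx, h⟩
    exact ⟨hx, by rw [h]; simp⟩

lemma convex_isState : Convex ℝ {x : Alg n | IsState x} := by
  rintro x ⟨hx, hx1⟩ y ⟨hy, hy1⟩ s t hs ht hst
  refine ⟨(hx.smul hs).add (hy.smul ht), ?_⟩
  change tr ((s : ℂ) • x + (t : ℂ) • y) = 1
  rw [tr_add, tr_smul, tr_smul, hx1, hy1, mul_one, mul_one, ← Complex.ofReal_add, hst,
    Complex.ofReal_one]

variable [∀ i, DecidableEq (n i)]

lemma isCompact_effects : IsCompact {G : Alg n | IsPos G ∧ IsPos (1 - G)} := by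
  refine (isCompact_isPos_tr_le (n := n) (tr (1 : Alg n)).re).of_isClosed_subset ?_ ?_
  · exact isClosed_isPos.inter (isClosed_isPos.preimage (continuous_const.sub continuous_id))
  · rintro G ⟨hG, hG1⟩
    refine ⟨hG, ?_⟩
    have := (Complex.le_def.1 hG1.tr_nonneg).1
    rw [tr_sub] at this
    simpa using this

omit [Fintype ι] [∀ i, Fintype (n i)] in
lemma convex_effects : Convex ℝ {G : Alg n | IsPos G ∧ IsPos (1 - G)} := by
  rintro x ⟨hx, hx1⟩ y ⟨hy, hy1⟩ s t hs ht hst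
  refine ⟨(hx.smul hs).add (hy.smul ht), ?_⟩
  have e : 1 - (s • x + t • y) = (s : ℂ) • (1 - x) + (t : ℂ) • (1 - y) := by
    have : (1 : Alg n) = (s : ℂ) • (1 : Alg n) + (t : ℂ) • (1 : Alg n) := by
      rw [← add_smul, ← Complex.ofReal_add, hst, Complex.ofReal_one, one_smul]
    conv_lhs => rw [this]
    change (s : ℂ) • (1 : Alg n) + (t : ℂ) • (1 : Alg n) - ((s : ℂ) • x + (t : ℂ) • y) = _
    module
  rw [e]
  exact (hx1.smul hs).add (hy1.smul ht)

end States

section ChoiExistence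

variable {ι : Type*} [Fintype ι] [DecidableEq ι] {n : ι → Type*} [∀ i, Fintype (n i)]
  [∀ i, DecidableEq (n i)] {k : ℕ}

/-- A nonzero trace forces a nonempty block; the witness is the Choi matrix of the channel that
prepares a fixed pure state there. -/
lemma exists_isPos_marg_eq_one {ρ : Alg (TensorShape n (Full k))} (hρ : tr ρ ≠ 0) :
    ∃ C : Alg (TensorShape n (Full k)), IsPos C ∧ marg C = 1 := by
  obtain ⟨i, x⟩ : ∃ i, Nonempty (n i) := by
    by_contra! h
    refine hρ (Finset.sum_eq_zero fun p _ => ?_)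
    have := h p.1
    exact Matrix.trace_eq_zero_of_isEmpty _
  obtain ⟨x⟩ := x
  have hx : (Matrix.single x x (1 : ℂ)).PosSemidef := by
    have := Matrix.posSemidef_vecMulVec_self_star (Pi.single x (1 : ℂ))
    rwa [← Pi.single_star, star_one, ← Matrix.single_eq_single_vecMulVec_single] at this
  have hm : IsPos (matUnit i x x : Alg n) := isPos_single hx
  refine ⟨tmul (matUnit i x x) (1 : Alg (Full k)), fun p =>
    (hm p.1).kronecker Matrix.PosSemidef.one, ?_⟩
  ext c d
  have e : slice (tmul (matUnit i x x) (1 : Alg (Full k))) c d =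
      ((1 : Matrix (Fin k) (Fin k) ℂ) c d) • (matUnit i x x : Alg n) := by
    ext j u v
    simp [slice, tmul, mul_comm]
  rw [marg_apply, e, tr_smul]
  have := tr_mul_single (1 : Alg n) i (Matrix.single x x 1)
  rw [one_mul, Pi.one_apply, one_mul, Matrix.trace_single_eq_same] at this
  rw [matUnit, this, mul_one]

end ChoiExistence

/-! ### Payoff maps as functionals of Choi matrices; the dual diamond norm. -/

section Payoff

variable {κ : Type*} [Fintype κ] [DecidableEq κ] {b : κ → Type*} [∀ j, Fintype (b j)]
  [∀ j, DecidableEq (b j)] {k : ℕ}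

omit [Fintype κ] [DecidableEq κ] [∀ j, Fintype (b j)] [∀ j, DecidableEq (b j)] in
lemma ofChoi_choi (φ : Alg (Full k) →ₗ[ℂ] Alg b) : ofChoi (choi φ) = φ := by
  refine LinearMap.ext fun x => ?_
  rw [map_eq_sum φ x]
  ext i u v
  simp [ofChoi, choi, Finset.sum_apply, Matrix.sum_apply]

/-- The pairing with `Γ` as a functional of the Choi matrix. -/
def payoff (Γ : Alg b →ₗ[ℂ] Alg (Full k)) : Alg (TensorShape b (Full k)) →ₗ[ℂ] ℂ where
  toFun P := sFunctional (ofChoi P ∘ₗ Γ)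
  map_add' P Q := by
    simp [sFunctional, ofChoi, mul_add, Finset.sum_add_distrib]
  map_smul' r P := by
    simp [sFunctional, ofChoi, Finset.mul_sum, mul_left_comm]

lemma pairing_eq_re_payoff (φ : Alg (Full k) →ₗ[ℂ] Alg b) (Γ : Alg b →ₗ[ℂ] Alg (Full k)) :
    pairing φ Γ = (payoff Γ (choi φ)).re := by
  rw [pairing, payoff, LinearMap.coe_mk, AddHom.coe_mk, ofChoi_choi]

lemma InDualCP.payoff_nonneg {Γ : Alg b →ₗ[ℂ] Alg (Full k)} (h : InDualCP Γ)
    {P : Alg (TensorShape b (Full k))} (hP : IsPos P) : 0 ≤ (payoff Γ P).re := by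
  have := h.2 (ofChoi P) (IsPos.isCP_of_choi (by rwa [choi_ofChoi]))
  rwa [pairing_eq_re_payoff, choi_ofChoi] at this

/-- Pairing `Γ` with the completely positive map `α - ξ` gives `⟨ξ, Γ⟩ ≤ ⟨α, Γ⟩`, so on the dual
cone only channels matter for the norm. -/
lemma InDualCP.pairing_le {Γ : Alg b →ₗ[ℂ] Alg (Full k)} (h : InDualCP Γ) {r : ℝ}
    (hr : ∀ α : Alg (Full k) →ₗ[ℂ] Alg b, IsChannel α → pairing α Γ ≤ r)
    {ξ : Alg (Full k) →ₗ[ℂ] Alg b} (hξ : ξ ∈ diamondBall) : pairing ξ Γ ≤ r := by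
  obtain ⟨α, hα, hαξ, -⟩ := hξ
  have h1 := h.payoff_nonneg hαξ.isPos_choi
  rw [choi_sub, map_sub, Complex.sub_re, ← pairing_eq_re_payoff, ← pairing_eq_re_payoff] at h1
  linarith [hr α hα]

lemma InDualCP.dualDiamondNorm_le {Γ : Alg b →ₗ[ℂ] Alg (Full k)} (h : InDualCP Γ) {r : ℝ}
    (hr0 : 0 ≤ r) (hr : ∀ α : Alg (Full k) →ₗ[ℂ] Alg b, IsChannel α → pairing α Γ ≤ r) :
    dualDiamondNorm Γ ≤ r := by
  refine Real.sSup_le ?_ hr0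
  rintro _ ⟨ξ, hξ, rfl⟩
  exact h.pairing_le hr hξ

lemma InDualCP.le_dualDiamondNorm {Γ : Alg b →ₗ[ℂ] Alg (Full k)} (h : InDualCP Γ)
    {α : Alg (Full k) →ₗ[ℂ] Alg b} (hα : IsChannel α)
    (hmax : ∀ α' : Alg (Full k) →ₗ[ℂ] Alg b, IsChannel α' → pairing α' Γ ≤ pairing α Γ) :
    pairing α Γ ≤ dualDiamondNorm Γ := by
  refine le_csSup ⟨pairing α Γ, ?_⟩ ⟨α, ⟨α, hα, ?_, ?_⟩, rfl⟩
  · rintro _ ⟨ξ, hξ, rfl⟩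
    exact h.pairing_le hmax hξ
  · rw [isCP_iff_isPos_choi, sub_self]
    exact isPos_zero
  · rw [isCP_iff_isPos_choi]
    exact hα.1.isPos_choi.add hα.1.isPos_choi

/-- The element `M ⊗ |c⟩⟨d|`. -/
def place (c d : Fin k) : Alg b →ₗ[ℂ] Alg (TensorShape b (Full k)) where
  toFun M := fun p => Matrix.of fun X Y => if X.2 = c ∧ Y.2 = d then M p.1 X.1 Y.1 else 0
  map_add' M N := by
    ext p X Y
    simp only [Matrix.of_apply, Pi.add_apply, Matrix.add_apply]
    split_ifs <;> simp
  map_smul' r M := by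
    ext p X Y
    simp

omit [Fintype κ] [∀ j, Fintype (b j)] in
lemma place_matUnit (j : κ) (x y : b j) (c d : Fin k) :
    place c d (matUnit j x y : Alg b) = matUnit (j, ()) (x, c) (y, d) := by
  ext ⟨i, ⟨⟩⟩ ⟨x', c'⟩ ⟨y', d'⟩
  rcases eq_or_ne i j with rfl | hij
  · rw [matUnit_apply_same]
    simp only [place, LinearMap.coe_mk, AddHom.coe_mk, Matrix.of_apply, matUnit_apply_same,
      Prod.mk.injEq, ← ite_and]
    congr 1
    exact propext ⟨fun h => ⟨⟨h.2.1, h.1.1.symm⟩, h.2.2, h.1.2.symm⟩,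
      fun h => ⟨⟨h.1.2.symm, h.2.2.symm⟩, h.1.1, h.2.1⟩⟩
  · have h1 : (i, ()) ≠ (j, ()) := fun h => hij (Prod.ext_iff.1 h).1
    simp [place, matUnit, Pi.single_eq_of_ne hij, Pi.single_eq_of_ne h1]

omit [Fintype κ] [DecidableEq κ] [∀ j, Fintype (b j)] [∀ j, DecidableEq (b j)] in
lemma place_star (c d : Fin k) (M : Alg b) : place c d (star M) = star (place d c M) := by
  ext p X Y
  simp only [place, LinearMap.coe_mk, AddHom.coe_mk, Matrix.of_apply, Pi.star_apply,
    Matrix.star_apply, and_comm (a := X.2 = c)]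
  split_ifs <;> simp

/-- The map with a given payoff functional. -/
def ofPayoff (g : Alg (TensorShape b (Full k)) →ₗ[ℂ] ℂ) : Alg b →ₗ[ℂ] Alg (Full k) where
  toFun M := fun _ => Matrix.of fun c d => g (place c d M)
  map_add' M N := by
    ext u c d
    simp
  map_smul' r M := by
    ext u c d
    simp

lemma payoff_ofPayoff (g : Alg (TensorShape b (Full k)) →ₗ[ℂ] ℂ)
    (P : Alg (TensorShape b (Full k))) : payoff (ofPayoff g) P = g P := by
  rw [map_eq_sum g P]
  simp only [payoff, sFunctional, ofChoi, ofPayoff, LinearMap.coe_mk, AddHom.coe_mk,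
    LinearMap.comp_apply, Matrix.of_apply, place_matUnit, Fintype.sum_prod_type,
    Finset.univ_unique, Finset.sum_singleton, smul_eq_mul]
  refine Finset.sum_congr rfl fun j _ => Finset.sum_congr rfl fun x _ => ?_
  rw [Finset.sum_comm]
  exact Finset.sum_congr rfl fun c _ => Finset.sum_congr rfl fun y _ =>
    Finset.sum_congr rfl fun d _ => mul_comm _ _

lemma inDualCP_ofPayoff {g : Alg (TensorShape b (Full k)) →ₗ[ℂ] ℂ}
    (hs : ∀ P, g (star P) = star (g P)) (hg : ∀ P, IsPos P → 0 ≤ (g P).re) :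
    InDualCP (ofPayoff g) := by
  refine ⟨fun M => ?_, fun φ hφ => ?_⟩
  · ext u c d
    simp only [ofPayoff, LinearMap.coe_mk, AddHom.coe_mk, Matrix.of_apply, Pi.star_apply,
      Matrix.star_apply, place_star, hs]
  · rw [pairing_eq_re_payoff, payoff_ofPayoff]
    exact hg _ hφ.isPos_choi

omit [Fintype κ] [DecidableEq κ] [∀ j, Fintype (b j)] [∀ j, DecidableEq (b j)] in
-- Effects constrain real parts only, whereas a payoff map has to be Hermitian.
lemma exists_symmetrization (g : Alg b →ₗ[ℂ] ℂ) :
    ∃ h : Alg b →ₗ[ℂ] ℂ, (∀ P, h (star P) = star (h P)) ∧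
      ∀ P, star P = P → (h P).re = (g P).re := by
  refine ⟨{ toFun := fun P => (1 / 2 : ℂ) * (g P + star (g (star P)))
            map_add' := fun P Q => by
              simp only [star_add, map_add]; ring
            map_smul' := fun r P => by
              simp only [star_smul, map_smul, smul_eq_mul, star_mul', star_star, RingHom.id_apply]
              ring }, fun P => ?_, fun P hP => ?_⟩
  · simp [add_comm]
  · simp only [LinearMap.coe_mk, AddHom.coe_mk, hP]
    simp
    ring

end Payoff

/-! ### The implications between deficiency, domination and range inclusion. -/

section Comparison

variable {ι ι' κ : Type*} [Fintype ι] [DecidableEq ι] [Fintype ι'] [DecidableEq ι'] [Fintype κ]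
  [DecidableEq κ]
  {a : ι → Type*} [∀ i, Fintype (a i)] [∀ i, DecidableEq (a i)]
  {a' : ι' → Type*} [∀ i, Fintype (a' i)] [∀ i, DecidableEq (a' i)]
  {b : κ → Type*} [∀ j, Fintype (b j)] [∀ j, DecidableEq (b j)]
  {Φ : Alg a →ₗ[ℂ] Alg b} {Ψ : Alg a' →ₗ[ℂ] Alg b} {k : ℕ} {ε : ℝ}

lemma RangeContains.effectDominated (H : RangeContains ε (stab k Ψ) (stab k Φ))
    (hΦ : IsChannel Φ) (hΨ : IsChannel Ψ) : EffectDominated k ε Ψ Φ := by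
  intro g hg σ hσ
  obtain ⟨ρ, hρ, h⟩ := H σ hσ
  refine ⟨ρ, hρ, ?_⟩
  obtain ⟨G, hG, hG1, hgG⟩ := hg.exists_re_tr_mul_eq
  have hs : star (stab k Φ σ - stab k Ψ ρ) = stab k Φ σ - stab k Ψ ρ := by
    rw [star_sub, (hΦ.isPos_stab hσ.1).star_eq, (hΨ.isPos_stab hρ.1).star_eq]
  have h1 := two_mul_re_tr_mul_le_traceNorm hs hG hG1
  rw [← hgG _ hs, tr_sub, tr_stab hΦ.2, tr_stab hΨ.2, hσ.2, hρ.2, map_sub] at h1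
  simp at h1
  linarith

omit [DecidableEq ι] in
-- Testing the dual bound on congruences of `C`, whose marginals `Bᴴ B` exhaust the positive
-- matrices, shows that `T` is positive.
lemma exists_posSemidef_dual {n : ι → Type*} [∀ i, Fintype (n i)] [∀ i, DecidableEq (n i)]
    {g : Alg (TensorShape n (Full k)) →ₗ[ℂ] ℂ}
    (hg : ∀ P, IsPos P → 0 ≤ (g P).re)
    (h0 : ∃ C : Alg (TensorShape n (Full k)), IsPos C ∧ marg C = 1) :
    ∃ (C : Alg (TensorShape n (Full k))) (T : Matrix (Fin k) (Fin k) ℂ),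
      IsPos C ∧ marg C = 1 ∧ (∀ C', IsPos C' → marg C' = 1 → (g C').re ≤ (g C).re) ∧
      T.PosSemidef ∧ T.trace.re = (g C).re ∧
      ∀ P, IsPos P → (g P).re ≤ (T * marg P).trace.re := by
  obtain ⟨C, T, hC, hC1, hmax, hT, htr, hle⟩ := exists_optimal_choi_and_dual g hg h0
  refine ⟨C, T, hC, hC1, hmax, posSemidef_of_re_trace_nonneg hT fun K hK => ?_, htr, hle⟩
  obtain ⟨B, rfl⟩ := exists_conjTranspose_mul_self hK
  have hp := hC.ampConj Bᴴ
  have h := (hg _ hp).trans (hle _ hp)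
  rwa [marg_ampConj, hC1, mul_one, Matrix.conjTranspose_conjTranspose] at h

theorem EffectDominated.preDeficient (H : EffectDominated k ε Ψ Φ) (hε : 0 ≤ ε)
    (hΦ : IsChannel Φ) (hΨ : IsChannel Ψ) :
    PreDeficient (ε + 1 / 2 * Real.sqrt ε) (Full k) Ψ Φ := by
  intro Γ hΓ β hβ
  have hg : ∀ P, IsPos P → 0 ≤ (payoff Γ P).re := fun P hP => hΓ.payoff_nonneg hP
  obtain ⟨hβ0, hβ1⟩ := isChannel_iff.1 hβ
  have hb : ∃ C : Alg (TensorShape b (Full k)), IsPos C ∧ marg C = 1 :=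
    ⟨stab k Φ (choi β), hΦ.isPos_stab hβ0, by rw [marg_stab hΦ.2, hβ1]⟩
  -- The input algebra of `Ψ` could a priori be zero. For `k > 0`, domination of the zero effect
  -- supplies a state; for `k = 0` the zero matrix works.
  have ha' : ∃ C : Alg (TensorShape a' (Full k)), IsPos C ∧ marg C = 1 := by
    rcases Nat.eq_zero_or_pos k with rfl | hk
    · exact ⟨0, isPos_zero, Subsingleton.elim _ _⟩
    · have htr : (tr (choi β)).re = k := by rw [← trace_marg, hβ1]; simp
      obtain ⟨ρ, hρ, -⟩ := H 0 (fun P hP => ⟨by simp, by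
        simpa using (Complex.le_def.1 hP.tr_nonneg).1⟩) _
        (hβ0.isState_smul (by exact_mod_cast hk) htr)
      exact exists_isPos_marg_eq_one (ρ := ρ) (by rw [hρ.2]; exact one_ne_zero)
  obtain ⟨Cb, S, hCb, hCb1, hCbmax, hS, hStr, hSle⟩ := exists_posSemidef_dual hg hb
  obtain ⟨C', T, hC', hC'1, -, hT, hTtr, hTle⟩ :=
    exists_posSemidef_dual (g := payoff Γ ∘ₗ stab k Ψ)
      (fun P hP => hg _ (hΨ.isPos_stab hP)) ha'
  refine ⟨ofChoi C', isChannel_iff.2 ⟨by rwa [choi_ofChoi], by rwa [choi_ofChoi]⟩, ?_⟩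
  rw [pairing_eq_re_payoff, pairing_eq_re_payoff, choi_comp, choi_comp, choi_ofChoi]
  have hnorm : S.trace.re ≤ dualDiamondNorm Γ := by
    have := hΓ.le_dualDiamondNorm (α := ofChoi Cb)
      (isChannel_iff.2 ⟨by rwa [choi_ofChoi], by rwa [choi_ofChoi]⟩) fun α' hα' => by
        obtain ⟨h0, h1⟩ := isChannel_iff.1 hα'
        rw [pairing_eq_re_payoff, pairing_eq_re_payoff, choi_ofChoi]
        exact hCbmax _ h0 h1
    rwa [pairing_eq_re_payoff, choi_ofChoi, ← hStr] at this
  set t := ε + 1 / 2 * Real.sqrt ε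
  have ht : 0 ≤ t := by positivity
  -- The congruence needs an invertible `S`, so `S` is replaced by `S + η` and `η` tends to zero
  -- afterwards.
  have key : ∀ η : ℝ, 0 < η →
      (payoff Γ (stab k Φ (choi β))).re ≤ T.trace.re + t * (S.trace.re + η * k) := by
    intro η hη
    have hSη : (S + (η : ℂ) • (1 : Matrix (Fin k) (Fin k) ℂ)).PosDef :=
      Matrix.PosDef.posSemidef_add hS (Matrix.PosDef.one.smul (by exact_mod_cast hη))
    have := H.re_le_trace hε hΦ hΨ hg hSη hT (fun P hP => (hSle P hP).trans (by
      rw [add_mul, Matrix.trace_add, Complex.add_re, smul_mul_assoc, one_mul, Matrix.trace_smul,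
        smul_eq_mul, Complex.re_ofReal_mul]
      have := (Complex.le_def.1 hP.marg.trace_nonneg).1
      have := mul_nonneg hη.le this
      linarith)) hTle (choi β) hβ0
    rw [hβ1, mul_one, mul_one] at this
    have e : (S + (η : ℂ) • (1 : Matrix (Fin k) (Fin k) ℂ)).trace.re = S.trace.re + η * k := by
      simp
    rwa [e] at this
  have h2 : (payoff Γ (stab k Φ (choi β))).re ≤ T.trace.re + t * S.trace.re := by
    refine le_of_forall_pos_le_add fun δ hδ => ?_
    have hpos : 0 < t * k + 1 := by positivity
    refine (key (δ / (t * k + 1)) (by positivity)).trans ?_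
    have : t * (δ / (t * k + 1) * k) ≤ δ := by
      rw [show t * (δ / (t * k + 1) * k) = δ * (t * k) / (t * k + 1) by ring,
        div_le_iff₀ hpos]
      nlinarith
    linarith
  rw [LinearMap.comp_apply] at hTtr
  rw [← hTtr]
  have := mul_le_mul_of_nonneg_left hnorm ht
  linarith

lemma PreDeficient.exists_state_of_pos (H : PreDeficient ε (Full k) Ψ Φ) (hε : 0 ≤ ε)
    (hΦ : IsChannel Φ) (hΨ : IsChannel Ψ)
    {g : Alg (TensorShape b (Full k)) →ₗ[ℂ] ℂ} (hg : IsEffect g)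
    {σ : Alg (TensorShape a (Full k))} (hσ : IsState σ) {η : ℝ} (hη : 0 < η) :
    ∃ ρ : Alg (TensorShape a' (Full k)), IsState ρ ∧
      (g (stab k Φ σ)).re ≤ (g (stab k Ψ ρ)).re + ε + η := by
  obtain ⟨E, hE, hE1⟩ := exists_isPos_marg_eq_one (ρ := σ) (by rw [hσ.2]; exact one_ne_zero)
  -- The perturbation costs `ε δ k` through the norm and at most `δ k` through normalisation, in
  -- total at most `η`.
  set δ := η / ((k + 1) * (1 + ε)) with hδ
  have hδ0 : 0 < δ := by positivity
  set P := σ + (δ : ℂ) • E with hPdef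
  have hP : IsPos P := hσ.1.add (hE.smul hδ0.le)
  have hτ : (marg P).PosDef := by
    rw [hPdef, map_add, map_smul, hE1]
    exact Matrix.PosDef.posSemidef_add hσ.1.marg (Matrix.PosDef.one.smul (by exact_mod_cast hδ0))
  have hτtr : (marg P).trace.re = 1 + δ * k := by
    rw [hPdef, map_add, map_smul, hE1, Matrix.trace_add, trace_marg, hσ.2]
    simp
  obtain ⟨B, hB⟩ := exists_conjTranspose_mul_self hτ.posSemidef
  have hBu : IsUnit B.det := by
    have := (Matrix.isUnit_iff_isUnit_det _).1 hτ.isUnit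
    rw [hB, Matrix.det_mul] at this
    exact isUnit_of_mul_isUnit_right this
  have hBi : B * B⁻¹ = 1 := Matrix.mul_nonsing_inv _ hBu
  have hBi' : (B⁻¹)ᴴ * Bᴴ = 1 := by
    rw [← Matrix.conjTranspose_mul, hBi, Matrix.conjTranspose_one]
  have hBj : B⁻¹ * B = 1 := Matrix.nonsing_inv_mul _ hBu
  have hBj' : Bᴴ * (B⁻¹)ᴴ = 1 := by
    rw [← Matrix.conjTranspose_mul, hBj, Matrix.conjTranspose_one]
  set C := ampConj (B⁻¹)ᴴ (B⁻¹) P with hCdef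
  have hC : IsPos C := by simpa using hP.ampConj (B⁻¹)ᴴ
  have hC1 : marg C = 1 := by
    rw [hCdef, marg_ampConj, hB, ← Matrix.mul_assoc, hBi', one_mul, hBi]
  have hconj : ∀ {υ : Type _} [Fintype υ] {n : υ → Type _} [∀ i, Fintype (n i)]
      [∀ i, DecidableEq (n i)] {Q : Alg (TensorShape n (Full k))}, IsPos Q →
        IsPos (ampConj Bᴴ B Q) := fun hQ => by simpa using hQ.ampConj Bᴴ
  have htrconj : ∀ Q : Alg (TensorShape b (Full k)), marg Q = 1 →
      (tr (ampConj Bᴴ B Q)).re = 1 + δ * k := fun Q hQ => by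
    rw [← trace_marg, marg_ampConj, hQ, mul_one, ← hB, hτtr]
  obtain ⟨h, hs, hh⟩ := exists_symmetrization (g ∘ₗ ampConj Bᴴ B)
  have hh' : ∀ Q : Alg (TensorShape b (Full k)), IsPos Q → (h Q).re = (g (ampConj Bᴴ B Q)).re :=
    fun Q hQ => hh Q hQ.star_eq
  have hdual : InDualCP (ofPayoff h) := inDualCP_ofPayoff hs fun Q hQ => by
    rw [hh' Q hQ]; exact (hg _ (hconj hQ)).1
  -- A Choi matrix of a channel is carried by the congruence to a positive element with the marginal
  -- of `P`, on which the effect `g` is at most the trace.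
  have hnorm : dualDiamondNorm (ofPayoff h) ≤ 1 + δ * k := by
    refine hdual.dualDiamondNorm_le (by positivity) fun α hα => ?_
    obtain ⟨h0, h1⟩ := isChannel_iff.1 hα
    rw [pairing_eq_re_payoff, payoff_ofPayoff, hh' _ h0, ← htrconj _ h1]
    exact (hg _ (hconj h0)).2
  obtain ⟨β', hβ', hle⟩ := H (ofPayoff h) hdual (ofChoi C)
    (isChannel_iff.2 ⟨by rwa [choi_ofChoi], by rwa [choi_ofChoi]⟩)
  obtain ⟨h0, h1⟩ := isChannel_iff.1 hβ'
  rw [pairing_eq_re_payoff, pairing_eq_re_payoff, payoff_ofPayoff, payoff_ofPayoff, choi_comp,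
    choi_comp, choi_ofChoi, hh' _ (hΦ.isPos_stab hC), hh' _ (hΨ.isPos_stab h0), ← stab_ampConj,
    ← stab_ampConj, hCdef, ampConj_ampConj, hBj', hBj, ampConj_one] at hle
  set Q := ampConj Bᴴ B (choi β') with hQdef
  have hQ : IsPos Q := by simpa using h0.ampConj Bᴴ
  have hQtr : (tr Q).re = 1 + δ * k := by
    rw [← trace_marg, hQdef, marg_ampConj, h1, mul_one, ← hB, hτtr]
  have hpos : 0 < 1 + δ * k := by positivity
  have hρ := hQ.isState_smul hpos hQtr
  refine ⟨_, hρ, ?_⟩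
  set ρ := (((1 + δ * k)⁻¹ : ℝ) : ℂ) • Q with hρdef
  have hQρ : (g (stab k Ψ Q)).re = (1 + δ * k) * (g (stab k Ψ ρ)).re := by
    rw [hρdef, map_smul, map_smul, smul_eq_mul, Complex.re_ofReal_mul, mul_inv_cancel_left₀ hpos.ne']
  have h2 : (g (stab k Φ σ)).re ≤ (g (stab k Φ P)).re := by
    rw [hPdef, map_add, map_add, map_smul, map_smul, Complex.add_re, smul_eq_mul,
      Complex.re_ofReal_mul]
    have := mul_nonneg hδ0.le (hg _ (hΦ.isPos_stab hE)).1
    linarith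
  have h3 : (g (stab k Ψ ρ)).re ≤ 1 := by
    have := (hg _ (hΨ.isPos_stab hρ.1)).2
    rw [tr_stab hΨ.2, hρ.2] at this
    simpa using this
  have h4 : δ * k * (1 + ε) ≤ η := by
    rw [hδ, show η / ((k + 1) * (1 + ε)) * k * (1 + ε) = η * k / (k + 1) by field_simp,
      div_le_iff₀ (by positivity)]
    nlinarith
  have h5 := mul_le_mul_of_nonneg_left hnorm hε
  have h6 : δ * k * (g (stab k Ψ ρ)).re ≤ δ * k * 1 :=
    mul_le_mul_of_nonneg_left h3 (by positivity)
  rw [hQρ] at hle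
  nlinarith

/-- A maximiser of `g ∘ (Ψ ⊗ id)` over the compact state space serves every `η`, which removes the
error. -/
theorem PreDeficient.effectDominated (H : PreDeficient ε (Full k) Ψ Φ) (hε : 0 ≤ ε)
    (hΦ : IsChannel Φ) (hΨ : IsChannel Ψ) : EffectDominated k ε Ψ Φ := by
  intro g hg σ hσ
  obtain ⟨ρ₀, hρ₀, -⟩ := H.exists_state_of_pos hε hΦ hΨ hg hσ one_pos
  obtain ⟨ρ, hρ, hmax⟩ := (isCompact_isState (n := TensorShape a' (Full k))).exists_isMaxOn
    ⟨ρ₀, hρ₀⟩ (Complex.continuous_re.comp (continuous_functional (g ∘ₗ stab k Ψ))).continuousOn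
  refine ⟨ρ, hρ, le_of_forall_pos_le_add fun η hη => ?_⟩
  obtain ⟨ρ', hρ', hle⟩ := H.exists_state_of_pos hε hΦ hΨ hg hσ hη
  have : (g (stab k Ψ ρ')).re ≤ (g (stab k Ψ ρ)).re := hmax hρ'
  linarith

/-- Left multiplication by `G` followed by the trace. -/
def trMul {n : ι → Type*} [∀ i, Fintype (n i)] (G : Alg n) : Alg n →ₗ[ℂ] ℂ where
  toFun x := tr (G * x)
  map_add' x y := by rw [mul_add, tr_add]
  map_smul' r x := by rw [mul_smul_comm, tr_smul]; rfl

omit [DecidableEq ι] in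
lemma tr_matUnit {n : ι → Type*} [∀ i, Fintype (n i)] [∀ i, DecidableEq (n i)] [DecidableEq ι]
    (i : ι) (x y : n i) : tr (matUnit i x y : Alg n) = if x = y then 1 else 0 := by
  have := tr_mul_single (1 : Alg n) i (Matrix.single x y 1)
  rw [one_mul, Pi.one_apply, one_mul] at this
  rw [matUnit, this]
  split_ifs with h
  · rw [h, Matrix.trace_single_eq_same]
  · rw [Matrix.trace_single_eq_of_ne _ _ _ h]

lemma tr_tensorMap_id {n : ι → Type*} [∀ i, Fintype (n i)] [∀ i, DecidableEq (n i)] {m : ℕ}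
    {ξ : Alg (Full k) →ₗ[ℂ] Alg (Full m)} (hξ : ∀ x, tr (ξ x) = tr x)
    (P : Alg (TensorShape n (Full k))) :
    tr (tensorMap (LinearMap.id : Alg n →ₗ[ℂ] Alg n) ξ P) = tr P := by
  have e : tensorMap (LinearMap.id : Alg n →ₗ[ℂ] Alg n) ξ P =
      ∑ c, ∑ d, tmul (slice P c d) (ξ (matUnit () c d)) := by
    ext p X Y
    simp only [tensorMap_apply, Finset.sum_apply, Matrix.sum_apply, tmul,
      Matrix.kroneckerMap_apply, LinearMap.id_apply]
  have h : ∀ (x : Alg n) (y : Alg (Full m)), tr (tmul x y) = tr x * tr y := fun x y => by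
    simp only [tr, tmul, Finset.sum_mul_sum, Fintype.sum_prod_type]
    exact Finset.sum_congr rfl fun i _ => Finset.sum_congr rfl fun j _ =>
      Matrix.trace_kronecker _ _
  simp only [e, tr_sum, h, hξ, tr_matUnit, mul_ite, mul_one, mul_zero, Finset.sum_ite_eq,
    Finset.mem_univ, if_true]
  rw [← trace_marg]
  rfl

theorem EffectDominated.rangeContains (H : EffectDominated k ε Ψ Φ)
    (hΦ : IsChannel Φ) (hΨ : IsChannel Ψ) {m : ℕ} {ξ : Alg (Full k) →ₗ[ℂ] Alg (Full m)}
    (hξ : IsChannel ξ) : RangeContains ε (tensorMap Ψ ξ) (tensorMap Φ ξ) := by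
  intro σ hσ
  let L : Alg (TensorShape b (Full k)) →ₗ[ℂ] Alg (TensorShape b (Full m)) :=
    tensorMap (LinearMap.id : Alg b →ₗ[ℂ] Alg b) ξ
  have hLtr : ∀ P, tr (L P) = tr P := tr_tensorMap_id hξ.2
  have hLΦ : ∀ P, tensorMap Φ ξ P = L (stab k Φ P) := tensorMap_eq_comp Φ ξ
  have hLΨ : ∀ P, tensorMap Ψ ξ P = L (stab k Ψ P) := tensorMap_eq_comp Ψ ξ
  have hLpos : ∀ P, IsPos P → IsPos (L P) := fun P hP => hξ.1.isPos_tensorMap_id hP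
  have heff : ∀ G : Alg (TensorShape b (Full m)), IsPos G → IsPos (1 - G) →
      IsEffect (trMul G ∘ₗ L) := fun G h0 h1 P hP => by
    have := isEffect_of_isPos h0 h1 (f := trMul G) (fun _ => rfl) (L P) (hLpos P hP)
    rwa [hLtr] at this
  let f : Alg (TensorShape a' (Full k)) → Alg (TensorShape b (Full m)) → ℝ := fun ρ G =>
    (tr (G * (tensorMap Φ ξ σ - tensorMap Ψ ξ ρ))).re
  have hf : ∀ ρ G, f ρ G = (tr (G * tensorMap Φ ξ σ)).re -
      Complex.reLm ((trMul G ∘ₗ tensorMap Ψ ξ).restrictScalars ℝ ρ) := fun ρ G => by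
    simp only [f, mul_sub, tr_sub, Complex.sub_re]
    rfl
  have hf' : ∀ ρ G, f ρ G =
      Complex.reLm ((trMul (tensorMap Φ ξ σ - tensorMap Ψ ξ ρ)).restrictScalars ℝ G) :=
    fun ρ G => by
      simp only [f, tr_mul_comm G]
      rfl
  have hfc : ∀ G, Continuous fun ρ => f ρ G := fun G => by
    simp only [hf]
    exact continuous_const.sub
      (Complex.continuous_re.comp (continuous_functional (trMul G ∘ₗ tensorMap Ψ ξ)))
  have hfc' : ∀ ρ, Continuous (f ρ) := fun ρ => by
    simp only [funext (hf' ρ)]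
    exact Complex.continuous_re.comp
      (continuous_functional (trMul (tensorMap Φ ξ σ - tensorMap Ψ ξ ρ)))
  obtain ⟨ρ₀, hρ₀, -⟩ := H 0 (fun P hP => ⟨by simp, by
    simpa using (Complex.le_def.1 hP.tr_nonneg).1⟩) σ hσ
  -- At the saddle point, `ρ` is good against every effect as soon as some state is good against the
  -- single effect `G`, and that is what domination provides.
  obtain ⟨ρ, hρ, G, hG, hsad⟩ := Sion.exists_isSaddlePointOn
    (X := {ρ : Alg (TensorShape a' (Full k)) | IsState ρ})
    (Y := {G : Alg (TensorShape b (Full m)) | IsPos G ∧ IsPos (1 - G)}) (f := f)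
    ⟨ρ₀, hρ₀⟩ convex_isState isCompact_isState
    (fun G _ => (hfc G).lowerSemicontinuous.lowerSemicontinuousOn _)
    (fun G _ => by
      simp only [hf]
      refine ConvexOn.quasiconvexOn ⟨convex_isState, fun x _ y _ s t _ _ hst => le_of_eq ?_⟩
      beta_reduce
      rw [map_add, map_add, map_smul, map_smul, map_smul, map_smul]
      simp only [smul_eq_mul]
      linear_combination (-(tr (G * tensorMap Φ ξ σ)).re) * hst)
    convex_effects ⟨0, isPos_zero, by rw [sub_zero]; exact fun _ => Matrix.PosSemidef.one⟩
    isCompact_effects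
    (fun ρ _ => (hfc' ρ).upperSemicontinuous.upperSemicontinuousOn _)
    (fun ρ _ => by
      simp only [funext (hf' ρ)]
      exact ((Complex.reLm ∘ₗ (trMul (tensorMap Φ ξ σ - tensorMap Ψ ξ ρ)).restrictScalars
        ℝ).concaveOn convex_effects).quasiconcaveOn)
  refine ⟨ρ, hρ, ?_⟩
  obtain ⟨ρ', hρ', hle⟩ := H (trMul G ∘ₗ L) (heff G hG.1 hG.2) σ hσ
  have hbound : f ρ' G ≤ ε := by
    simp only [f, mul_sub, tr_sub, Complex.sub_re, hLΦ, hLΨ]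
    have : (tr (G * L (stab k Φ σ))).re ≤ (tr (G * L (stab k Ψ ρ'))).re + ε := hle
    linarith
  have hposΦ : IsPos (tensorMap Φ ξ σ) := by
    rw [hLΦ]; exact hLpos _ (hΦ.isPos_stab hσ.1)
  have hposΨ : IsPos (tensorMap Ψ ξ ρ) := by
    rw [hLΨ]; exact hLpos _ (hΨ.isPos_stab hρ.1)
  -- The difference of the two outputs has trace zero, so its trace norm is twice its largest effect
  -- value; hence the factor `2` in `2 ε`.
  obtain ⟨G', h0, h1, hG'⟩ := exists_two_mul_re_tr_mul_eq_traceNorm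
    (x := tensorMap Φ ξ σ - tensorMap Ψ ξ ρ) (by rw [star_sub, hposΦ.star_eq, hposΨ.star_eq])
  have htr : tr (tensorMap Φ ξ σ - tensorMap Ψ ξ ρ) = 0 := by
    rw [tr_sub, hLΦ, hLΨ, hLtr, hLtr, tr_stab hΦ.2, tr_stab hΨ.2, hσ.2, hρ.2, sub_self]
  have h2 : f ρ G' ≤ f ρ' G := hsad ρ' hρ' G' ⟨h0, h1⟩
  rw [htr, Complex.zero_re, zero_add] at hG'
  rw [← hG']
  have : (tr (G' * (tensorMap Φ ξ σ - tensorMap Ψ ξ ρ))).re ≤ ε := h2.trans hbound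
  linarith

end Comparison

lemma isChannel_id (k : ℕ) : IsChannel (LinearMap.id : Alg (Full k) →ₗ[ℂ] Alg (Full k)) := by
  refine ⟨fun r P hP => ?_, fun _ => rfl⟩
  have : tensorMap (LinearMap.id : Alg (Full k) →ₗ[ℂ] Alg (Full k))
      (LinearMap.id : Alg (Full r) →ₗ[ℂ] Alg (Full r)) P = P :=
    ext_slice fun c d => slice_stab LinearMap.id P c d
  rwa [this]

end ChannelComparison

theorem mainTheorem7
    {ι ι' κ : Type*} [Fintype ι] [DecidableEq ι] [Fintype ι'] [DecidableEq ι']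
    [Fintype κ] [DecidableEq κ]
    {a : ι → Type*} [∀ i, Fintype (a i)] [∀ i, DecidableEq (a i)]
    {a' : ι' → Type*} [∀ i, Fintype (a' i)] [∀ i, DecidableEq (a' i)]
    {b : κ → Type*} [∀ j, Fintype (b j)] [∀ j, DecidableEq (b j)]
    (Φ : Alg a →ₗ[ℂ] Alg b) (hΦ : IsChannel Φ)
    (Ψ : Alg a' →ₗ[ℂ] Alg b) (hΨ : IsChannel Ψ)
    (k : ℕ) (ε : ℝ) (hε : 0 ≤ ε) :
    (PreDeficient ε (Full k) Ψ Φ →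
      ∀ (m : ℕ) (ξ : Alg (Full k) →ₗ[ℂ] Alg (Full m)), IsChannel ξ →
        RangeContains ε (tensorMap Ψ ξ) (tensorMap Φ ξ)) ∧
    ((∀ (m : ℕ) (ξ : Alg (Full k) →ₗ[ℂ] Alg (Full m)), IsChannel ξ →
        RangeContains ε (tensorMap Ψ ξ) (tensorMap Φ ξ)) →
      RangeContains ε
        (tensorMap Ψ (LinearMap.id : Alg (Full k) →ₗ[ℂ] Alg (Full k)))
        (tensorMap Φ (LinearMap.id : Alg (Full k) →ₗ[ℂ] Alg (Full k)))) ∧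
    (RangeContains ε
        (tensorMap Ψ (LinearMap.id : Alg (Full k) →ₗ[ℂ] Alg (Full k)))
        (tensorMap Φ (LinearMap.id : Alg (Full k) →ₗ[ℂ] Alg (Full k))) →
      PreDeficient (ε + 1 / 2 * Real.sqrt ε) (Full k) Ψ Φ) :=
  ⟨fun H _ _ hξ => (H.effectDominated hε hΦ hΨ).rangeContains hΦ hΨ hξ,
    fun H => H k LinearMap.id (isChannel_id k),
    fun H => (RangeContains.effectDominated H hΦ hΨ).preDeficient hε hΦ hΨ⟩
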